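/- Let $q$ be a prime power and call an $n$-tuple of distinct points of $\mathbb{P}^3(\mathbb{F}_q)$ an (ordered) $n$-cap if no three of its points lie on a line; let $c_{n,3}(q)$ be the number of ordered $n$-caps ($n!$ times the number of $n$-element caps). A planar space on a finite point set $\mathcal P$ consists of sets $\mathcal L,\mathcal H\subseteq 2^{\mathcal P}$ of lines and planes such that every line has at least two points, any two distinct points lie on exactly one line, any three distinct non-collinear points lie on exactly one plane, and every plane contains three non-collinear points. A line is full if it has at least three points, a plane is full if it has at least four points. Isomorphisms are bijections of the points preserving lines and planes. A hyperfiguration is a planar space, on at least one point, in which every point $P$ satisfies at least one of $i\ge 4$, $j\ge 3$, $(i,j)=(3,0)$, where $i$ and $j$ are the numbers of full planes and of full lines through $P$. A strong realization of a planar space $f$ is an injective map $\sigma:\mathcal P\to\mathbb P^3(\mathbb F_q)$ such that, for every $S\subseteq\mathcal P$, $\sigma(S)$ lies on a line if and only if $|S|\le 1$ or $S$ is contained in a line of $f$, and $\sigma(S)$ lies in a plane if and only if $|S|\le 1$ or $S$ is contained in a line or in a plane of $f$. Let $A_f(4,q)$ be the number of strong realizations of $f$; it depends only on the isomorphism class of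 $f$. **Theorem.** For every $n\ge 0$ there are polynomials $s(q)=s^{(n)}(q)$ and $s_h(q)=s^{(n)}_h(q)$ in $\mathbb Z[q]$ such that for every prime power $q$ $$c_{n,3}(q)=s(q)+\sum_h s_h(q)\,A_h(4,q),$$ where $h$ runs over the isomorphism classes of hyperfigurations on at most $n$ points. Moreover $s$ (from $n$) and $s_h$ (from $n$ and $h$) are produced by the following algorithm. 1. For each planar space $f$ on $m$ points, compute polynomials $r_f$ and $r_{f,h}$ in $\mathbb Z[q]$ such that $A_f(4,q)=r_f(q)+\sum_h r_{f,h}(q)A_h(4,q)$ for every prime power $q$, where $h$ runs over the isomorphism classes of hyperfigurations on at most $m$ points. (Such polynomials exist, and there is an algorithm that computes $r_f$ from $f$ and $r_{f,h}$ from $f$ and $h$.) 2. Output $s=\sum_f r_f$ and $s_h=\sum_f r_{f,h}$, where $f$ runs over the set $\mathcal N_n$ of planar spaces on the point set $\{0,\dots,n-1\}$ without full lines; here $c_{n,3}(q)=\sum_{f\in\mathcal N_n}A_f(4,q)$ for every prime power $q$. -/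

import Mathlib

open Polynomial

universe u

/-! ### Points, lines and planes of projective 3-space over a field -/

/-- Projective 3-space over `F`: the one-dimensional subspaces of `F⁴`. -/
abbrev P3 (F : Type u) [Field F] : Type u := Projectivization F (Fin 4 → F)

/-- The set of points `S` is contained in a `d`-dimensional projective subspace. -/
def ContainedInFlat {F : Type u} [Field F] (d : ℕ) (S : Set (P3 F)) : Prop :=
  ∃ W : Submodule F (Fin 4 → F), Module.finrank F W = d + 1 ∧ ∀ x ∈ S, x.submodule ≤ W

/-- `S` is contained in a line of projective 3-space. -/
def InLine {F : Type u} [Field F] (S : Set (P3 F)) : Prop := ContainedInFlat 1 S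

/-- `S` is contained in a plane of projective 3-space. -/
def InPlane {F : Type u} [Field F] (S : Set (P3 F)) : Prop := ContainedInFlat 2 S

/-- A cap: no three distinct points of `S` lie on a line. -/
def IsCap {F : Type u} [Field F] (S : Set (P3 F)) : Prop :=
  ∀ a ∈ S, ∀ b ∈ S, ∀ c ∈ S, a ≠ b → a ≠ c → b ≠ c → ¬ InLine ({a, b, c} : Set (P3 F))

/-- `c_{n,3}(q)`, the number of (ordered) `n`-caps: `n`-tuples of distinct points that form a cap.
This is `n!` times the number of `n`-element sets that are caps. -/
noncomputable def capCount (n : ℕ) (F : Type u) [Field F] : ℕ :=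
  Nat.card {v : Fin n → P3 F // Function.Injective v ∧ IsCap (Set.range v)}

/-! ### Planar spaces -/

/-- A planar space on the points `0, …, m - 1`. All lines (also those with two points) and all
planes (also those with three points) are listed; a plane is required not to be collinear. -/
@[ext]
structure PlanarSpace (m : ℕ) where
  lines : Finset (Finset (Fin m))
  planes : Finset (Finset (Fin m))
  two_le_card_line : ∀ L ∈ lines, 2 ≤ L.card
  existsUnique_line : ∀ a b : Fin m, a ≠ b → ∃! L, L ∈ lines ∧ a ∈ L ∧ b ∈ L
  existsUnique_plane : ∀ a b c : Fin m, a ≠ b → a ≠ c → b ≠ c →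
    (¬ ∃ L ∈ lines, a ∈ L ∧ b ∈ L ∧ c ∈ L) → ∃! H, H ∈ planes ∧ a ∈ H ∧ b ∈ H ∧ c ∈ H
  plane_noncollinear : ∀ H ∈ planes, 3 ≤ H.card ∧ ∀ L ∈ lines, ¬ H ⊆ L

namespace PlanarSpace

variable {m : ℕ}

/-- `S` lies on a line of the planar space (at most one point is always collinear). -/
def Collinear (f : PlanarSpace m) (S : Finset (Fin m)) : Prop :=
  S.card ≤ 1 ∨ ∃ L ∈ f.lines, S ⊆ L

/-- `S` lies on a plane of the planar space, or is already collinear. -/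
def Coplanar (f : PlanarSpace m) (S : Finset (Fin m)) : Prop :=
  f.Collinear S ∨ ∃ H ∈ f.planes, S ⊆ H

/-- Strong realizations: injective maps to projective 3-space under which exactly the collinear
sets become collinear, and exactly the coplanar sets become coplanar. -/
structure IsStrongRealization (f : PlanarSpace m) {F : Type u} [Field F] (σ : Fin m → P3 F) :
    Prop where
  injective : Function.Injective σ
  inLine_iff : ∀ S : Finset (Fin m), InLine (σ '' (S : Set (Fin m))) ↔ f.Collinear S
  inPlane_iff : ∀ S : Finset (Fin m), InPlane (σ '' (S : Set (Fin m))) ↔ f.Coplanar S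

/-- `A_f(4, q)`, the number of strong realizations of `f` in projective 3-space over `F`. -/
noncomputable def realizationCount (f : PlanarSpace m) (F : Type u) [Field F] : ℕ :=
  Nat.card {σ : Fin m → P3 F // f.IsStrongRealization σ}

/-- The number of full planes (planes with at least four points) through `p`. -/
def planeIndex (f : PlanarSpace m) (p : Fin m) : ℕ :=
  (f.planes.filter fun H => p ∈ H ∧ 4 ≤ H.card).card

/-- The number of full lines (lines with at least three points) through `p`. -/
def lineIndex (f : PlanarSpace m) (p : Fin m) : ℕ :=
  (f.lines.filter fun L => p ∈ L ∧ 3 ≤ L.card).card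

/-- The index condition that defines hyperfigurations. -/
def IsHyperfiguration (f : PlanarSpace m) : Prop :=
  ∀ p : Fin m, 4 ≤ f.planeIndex p ∨ 3 ≤ f.lineIndex p ∨ (f.planeIndex p = 3 ∧ f.lineIndex p = 0)

/-- Isomorphism: a bijection of the points that preserves lines and planes. -/
def Isomorphic (f g : PlanarSpace m) : Prop :=
  ∃ ρ : Equiv.Perm (Fin m), ∀ S : Finset (Fin m),
    (S.map ρ.toEmbedding ∈ g.lines ↔ S ∈ f.lines) ∧
    (S.map ρ.toEmbedding ∈ g.planes ↔ S ∈ f.planes)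

theorem Isomorphic.refl (f : PlanarSpace m) : f.Isomorphic f :=
  ⟨Equiv.refl _, fun S => by simp⟩

theorem Isomorphic.symm {f g : PlanarSpace m} (h : f.Isomorphic g) : g.Isomorphic f := by
  obtain ⟨ρ, hρ⟩ := h
  refine ⟨ρ.symm, fun S => ?_⟩
  have h1 := hρ (S.map ρ.symm.toEmbedding)
  have h2 : (S.map ρ.symm.toEmbedding).map ρ.toEmbedding = S := by ext; simp
  rw [h2] at h1
  exact ⟨h1.1.symm, h1.2.symm⟩

theorem Isomorphic.trans {f g k : PlanarSpace m} (h : f.Isomorphic g) (h' : g.Isomorphic k) :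
    f.Isomorphic k := by
  obtain ⟨ρ, hρ⟩ := h
  obtain ⟨τ, hτ⟩ := h'
  refine ⟨ρ.trans τ, fun S => ?_⟩
  have h2 : S.map (ρ.trans τ).toEmbedding = (S.map ρ.toEmbedding).map τ.toEmbedding := by
    rw [Finset.map_map]; rfl
  rw [h2]
  exact ⟨(hτ _).1.trans (hρ S).1, (hτ _).2.trans (hρ S).2⟩

theorem Isomorphic.collinear {f g : PlanarSpace m} {ρ : Equiv.Perm (Fin m)}
    (hρ : ∀ S : Finset (Fin m), S.map ρ.toEmbedding ∈ g.lines ↔ S ∈ f.lines)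
    (S : Finset (Fin m)) : g.Collinear (S.map ρ.toEmbedding) ↔ f.Collinear S := by
  unfold Collinear
  rw [Finset.card_map]
  refine or_congr Iff.rfl ⟨?_, ?_⟩
  · rintro ⟨L, hL, hS⟩
    have h2 : (L.map ρ.symm.toEmbedding).map ρ.toEmbedding = L := by ext; simp
    refine ⟨L.map ρ.symm.toEmbedding, (hρ _).1 (by rwa [h2]), ?_⟩
    rwa [← h2, Finset.map_subset_map] at hS
  · rintro ⟨L, hL, hS⟩
    exact ⟨L.map ρ.toEmbedding, (hρ _).2 hL, Finset.map_subset_map.2 hS⟩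

theorem Isomorphic.coplanar {f g : PlanarSpace m} {ρ : Equiv.Perm (Fin m)}
    (hρ : ∀ S : Finset (Fin m), (S.map ρ.toEmbedding ∈ g.lines ↔ S ∈ f.lines) ∧
      (S.map ρ.toEmbedding ∈ g.planes ↔ S ∈ f.planes))
    (S : Finset (Fin m)) : g.Coplanar (S.map ρ.toEmbedding) ↔ f.Coplanar S := by
  unfold Coplanar
  refine or_congr (Isomorphic.collinear (fun T => (hρ T).1) S) ⟨?_, ?_⟩
  · rintro ⟨L, hL, hS⟩
    have h2 : (L.map ρ.symm.toEmbedding).map ρ.toEmbedding = L := by ext; simp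
    refine ⟨L.map ρ.symm.toEmbedding, (hρ _).2.1 (by rwa [h2]), ?_⟩
    rwa [← h2, Finset.map_subset_map] at hS
  · rintro ⟨L, hL, hS⟩
    exact ⟨L.map ρ.toEmbedding, (hρ _).2.2 hL, Finset.map_subset_map.2 hS⟩

theorem Isomorphic.realizationCount_eq {f g : PlanarSpace m} (h : f.Isomorphic g)
    (F : Type u) [Field F] : f.realizationCount F = g.realizationCount F := by
  obtain ⟨ρ, hρ⟩ := h
  refine Nat.card_congr ((ρ.arrowCongr (Equiv.refl (P3 F))).subtypeEquiv fun σ => ?_)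
  have key : ∀ S : Finset (Fin m),
      (σ ∘ ρ.symm) '' ((S.map ρ.toEmbedding : Finset (Fin m)) : Set (Fin m)) =
        σ '' (S : Set (Fin m)) := by
    intro S
    ext x
    constructor
    · rintro ⟨y, hy, rfl⟩
      exact ⟨ρ.symm y, by simpa using hy, rfl⟩
    · rintro ⟨y, hy, rfl⟩
      exact ⟨ρ y, by simpa using hy, by simp⟩
  have surj : ∀ T : Finset (Fin m), ∃ S : Finset (Fin m), S.map ρ.toEmbedding = T :=
    fun T => ⟨T.map ρ.symm.toEmbedding, by ext; simp⟩
  change f.IsStrongRealization σ ↔ g.IsStrongRealization (σ ∘ ρ.symm)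
  constructor
  · intro hσ
    refine ⟨hσ.injective.comp ρ.symm.injective, fun T => ?_, fun T => ?_⟩
    · obtain ⟨S, rfl⟩ := surj T
      rw [key, Isomorphic.collinear (fun T => (hρ T).1), hσ.inLine_iff]
    · obtain ⟨S, rfl⟩ := surj T
      rw [key, Isomorphic.coplanar hρ, hσ.inPlane_iff]
  · intro hσ
    refine ⟨?_, fun S => ?_, fun S => ?_⟩
    · have := hσ.injective.comp ρ.injective
      rwa [Function.comp_assoc, Equiv.symm_comp_self, Function.comp_id] at this
    · rw [← key, hσ.inLine_iff, Isomorphic.collinear (fun T => (hρ T).1)]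
    · rw [← key, hσ.inPlane_iff, Isomorphic.coplanar hρ]

instance : Finite (PlanarSpace m) :=
  Finite.of_injective (fun f : PlanarSpace m => (f.lines, f.planes)) fun f g h => by
    simp only [Prod.mk.injEq] at h
    exact PlanarSpace.ext h.1 h.2

noncomputable instance : Fintype (PlanarSpace m) := Fintype.ofFinite _

open Classical in
/-- The planar spaces on `0, …, n - 1` without full lines. -/
noncomputable def withoutFullLines (n : ℕ) : Finset (PlanarSpace n) :=
  Finset.univ.filter fun f => ∀ L ∈ f.lines, L.card ≤ 2

end PlanarSpace

/-! ### Hyperfigurations up to isomorphism -/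

/-- Hyperfigurations on the points `0, …, k - 1`. -/
abbrev Hyperfiguration (k : ℕ) : Type := {f : PlanarSpace k // f.IsHyperfiguration}

instance hyperfigurationSetoid (k : ℕ) : Setoid (Hyperfiguration k) where
  r f g := f.1.Isomorphic g.1
  iseqv := ⟨fun f => .refl f.1, fun h => h.symm, fun h h' => h.trans h'⟩

/-- Isomorphism classes of hyperfigurations on `k` points. -/
def HyperfigurationClass (k : ℕ) : Type := Quotient (hyperfigurationSetoid k)

namespace HyperfigurationClass

/-- The isomorphism class of a hyperfiguration. -/
def mk {k : ℕ} (h : Hyperfiguration k) : HyperfigurationClass k := Quotient.mk _ h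

/-- `A_h(4, q)` for an isomorphism class `h`. -/
noncomputable def realizationCount {k : ℕ} (h : HyperfigurationClass k) (F : Type u) [Field F] :
    ℕ :=
  Quotient.lift (fun f : Hyperfiguration k => f.1.realizationCount F)
    (fun _ _ hfg => PlanarSpace.Isomorphic.realizationCount_eq hfg F) h

instance (k : ℕ) : Finite (HyperfigurationClass k) :=
  inferInstanceAs (Finite (Quotient (hyperfigurationSetoid k)))

noncomputable instance (k : ℕ) : Fintype (HyperfigurationClass k) := Fintype.ofFinite _

end HyperfigurationClass

/-- For polynomials `p` and `p_h`, one for each isomorphism class `h` of hyperfigurations, the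
value of `p(q) + ∑ h, p_h(q) A_h(4, q)` at `q = #F`, where `h` runs over the isomorphism classes of
(nonempty) hyperfigurations on at most `n` points. -/
noncomputable def hyperfigurationSum (n : ℕ) (p : ℤ[X])
    (ph : ∀ k : ℕ, HyperfigurationClass k → ℤ[X]) (F : Type u) [Field F] [Fintype F] : ℤ :=
  p.eval (Fintype.card F : ℤ) +
    ∑ k ∈ Finset.Icc 1 n, ∑ h : HyperfigurationClass k,
      (ph k h).eval (Fintype.card F : ℤ) * (h.realizationCount F : ℤ)

/-! ### Algorithms that output integer polynomials -/

/-- The members of a family of subsets of `0, …, m - 1`, as a list of increasing lists of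
numbers. -/
def familyCode {m : ℕ} (𝓢 : Finset (Finset (Fin m))) : List (List ℕ) :=
  ((List.finRange m).sublists.filter fun l => l.toFinset ∈ 𝓢).map fun l => l.map Fin.val

/-- A planar space as input of an algorithm: the number of points, the lines, the planes. -/
def PlanarSpace.code {m : ℕ} (f : PlanarSpace m) : ℕ × List (List ℕ) × List (List ℕ) :=
  (m, familyCode f.lines, familyCode f.planes)

/-- The polynomial with the listed coefficients, constant term first. -/
noncomputable def polyOfCoeffs (l : List ℤ) : ℤ[X] :=
  l.foldr (fun a p => C a + X * p) 0

/-- Some algorithm computes, from the code of an object `b`, the coefficients of the polynomial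
`p b`. -/
def AlgorithmicallyComputable {α β : Type} [Primcodable α] (code : β → α) (p : β → ℤ[X]) : Prop :=
  ∃ φ : α → List ℤ, Computable φ ∧ ∀ b : β, polyOfCoeffs (φ (code b)) = p b

/-! Fix a point P of a planar space f and realize the other points. P must lie in the intersection W
of the flats through P that are spanned by other points. Suppose that W is already the intersection
of at most two of these flats (`Located`). Then the dimension formula gives the dimension d of W
from ranks in f alone, so W has 1 + q + … + q^(d-1) points. The points already placed in W are also
read off from f (`Coincident`). Putting P on any remaining point of W yields precisely the strong
realizations of the planar spaces g that agree with f away from P and keep its dependencies through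
P, f being one of them (`exists_degenerates_iff`). Hence, by `Located.count`, ∑ A_g = (1 + … +
q^(d-1) - #coincident) · A_(f-P), the sum running over the degenerations g of f.

Solving for A_f expresses it by spaces with fewer points or with smaller ranks. The number of points
plus the sum of all ranks (`weight`) drops strictly, so the recursion ends. A space violating
`ClosureMono` has no realizations and is dropped. If `ClosureMono` holds and no point is located,
the space satisfies the index condition: `ClosureMono.exists_located` shows that a point violating
that condition lies on so few full lines and planes that two of the flats through it suffice. What
remains are hyperfigurations and the empty space, whose count is 1 and which supplies the polynomial
without a factor A_h.

For caps, every injective family of points strongly realizes exactly one planar space, and it is a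
cap if and only if this space has no full lines (`capCount_eq_sum`).

For the algorithm, the recursion is run on lists of signed monomials times codes of spaces, for a
number of steps known in advance. Every test is a bounded search, so the whole procedure is
primitive recursive. The lemmas ending in `_code` identify the tests on codes with the conditions on
planar spaces. -/

namespace PlanarSpace

variable {m : ℕ}

/-! ### The rank function of a planar space. -/

open Classical in
/-- The rank of a set of points of a planar space: one more than the dimension of its span. -/
noncomputable def rank (f : PlanarSpace m) (S : Finset (Fin m)) : ℕ :=
  if S.card ≤ 1 then S.card else if f.Collinear S then 2 else if f.Coplanar S then 3 else 4

/-- If `x` is in the span of `S`, then `x` is in the span of every larger set. -/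
def ClosureMono (f : PlanarSpace m) : Prop :=
  ∀ S T : Finset (Fin m), S ⊆ T → ∀ x, f.rank (insert x S) = f.rank S →
    f.rank (insert x T) = f.rank T

/-- `S` does not contain `P` and spans a proper flat through `P`. -/
def Spans (f : PlanarSpace m) (P : Fin m) (S : Finset (Fin m)) : Prop :=
  P ∉ S ∧ f.rank (insert P S) = f.rank S ∧ f.rank S ≠ 4

/-- The intersection of the flats through `P` spanned by other points is the intersection of at
most two of them, and its expected vector space dimension is `d`. -/
def Located (f : PlanarSpace m) (P : Fin m) (d : ℕ) : Prop :=
  (d = 4 ∧ ∀ S, ¬ f.Spans P S) ∨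
    ∃ A B, f.Spans P A ∧ f.Spans P B ∧
      (∀ S, f.Spans P S → f.rank (S ∪ A) = f.rank S ∨ f.rank (S ∪ B) = f.rank S) ∧
      d = f.rank A + f.rank B - f.rank (A ∪ B)

/-- `g` agrees with `f` away from `P`, and `P` satisfies in `g` at least the same dependencies as
in `f`. -/
def Degenerates (f : PlanarSpace m) (P : Fin m) (g : PlanarSpace m) : Prop :=
  (∀ S, P ∉ S → g.rank S = f.rank S) ∧
    (∀ S, f.Spans P S → g.rank (insert P S) = g.rank S) ∧ ∀ S, g.rank S ≤ f.rank S

/-- `Q` lies on every flat through `P` that is spanned by other points. -/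
def Coincident (f : PlanarSpace m) (P Q : Fin m) : Prop :=
  Q ≠ P ∧ ∀ S, f.Spans P S → f.rank (insert Q S) = f.rank S

/-- `g` is `f` with the point `P` deleted. -/
def IsDeletion (f : PlanarSpace (m + 1)) (P : Fin (m + 1)) (g : PlanarSpace m) : Prop :=
  ∀ S, g.rank S = f.rank (S.map P.succAboveEmb)

variable {f g : PlanarSpace m} {S T : Finset (Fin m)}

theorem Collinear.subset (h : f.Collinear T) (hST : S ⊆ T) : f.Collinear S := by
  rcases h with h | ⟨L, hL, h⟩
  · exact .inl ((Finset.card_le_card hST).trans h)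
  · exact .inr ⟨L, hL, hST.trans h⟩

theorem Coplanar.subset (h : f.Coplanar T) (hST : S ⊆ T) : f.Coplanar S := by
  rcases h with h | ⟨L, hL, h⟩
  · exact .inl (h.subset hST)
  · exact .inr ⟨L, hL, hST.trans h⟩

theorem rank_le_four : f.rank S ≤ 4 := by
  unfold rank; split_ifs <;> omega

theorem rank_of_card_le_one (h : S.card ≤ 1) : f.rank S = S.card := if_pos h

theorem rank_le_one_iff : f.rank S ≤ 1 ↔ S.card ≤ 1 := by
  unfold rank; split_ifs <;> omega

theorem rank_le_two_iff : f.rank S ≤ 2 ↔ f.Collinear S := by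
  unfold rank
  split_ifs with h1 h2 h3
  · exact ⟨fun _ => .inl h1, fun _ => by omega⟩
  all_goals simp [h2]

theorem rank_le_three_iff : f.rank S ≤ 3 ↔ f.Coplanar S := by
  unfold rank
  split_ifs with h1 h2 h3
  · exact ⟨fun _ => .inl (.inl h1), fun _ => by omega⟩
  · exact ⟨fun _ => .inl h2, fun _ => by omega⟩
  all_goals simp [h3]

/-- Having rank at most 1, at most 2 or at most 3 passes to subsets; as ranks are at most 4, these
thresholds decide the comparison. -/
theorem rank_mono (h : S ⊆ T) : f.rank S ≤ f.rank T := by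
  have hc := Finset.card_le_card h
  have h1 := @rank_le_two_iff m f
  have h2 := @rank_le_three_iff m f
  by_cases a : T.card ≤ 1
  · rw [rank_of_card_le_one a, rank_of_card_le_one (hc.trans a)]; exact hc
  have b : ¬ f.rank T ≤ 1 := fun b => a (rank_le_one_iff.1 b)
  have c : f.rank T ≤ 2 → f.rank S ≤ 2 := fun c => h1.2 ((h1.1 c).subset h)
  have d : f.rank T ≤ 3 → f.rank S ≤ 3 := fun c => h2.2 ((h2.1 c).subset h)
  have e := @rank_le_four m f S
  omega

theorem two_le_rank (h : 2 ≤ S.card) : 2 ≤ f.rank S := by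
  by_contra h'
  have := (@rank_le_one_iff m f S).1 (by omega)
  omega

theorem rank_eq_two_iff : f.rank S = 2 ↔ f.Collinear S ∧ 2 ≤ S.card := by
  have h1 := @rank_le_two_iff m f S
  have h2 := @rank_le_one_iff m f S
  constructor
  · intro h
    exact ⟨h1.1 (by omega), by omega⟩
  · rintro ⟨h, h'⟩
    have := h1.2 h
    omega

theorem rank_eq_three_iff : f.rank S = 3 ↔ f.Coplanar S ∧ ¬ f.Collinear S := by
  rw [← rank_le_two_iff, ← rank_le_three_iff]; omega

theorem line_eq {L L' : Finset (Fin m)} (hL : L ∈ f.lines) (hL' : L' ∈ f.lines) {a b : Fin m}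
    (hab : a ≠ b) (ha : a ∈ L) (hb : b ∈ L) (ha' : a ∈ L') (hb' : b ∈ L') : L = L' :=
  (f.existsUnique_line a b hab).unique ⟨hL, ha, hb⟩ ⟨hL', ha', hb'⟩

theorem collinear_of_subset_line {L : Finset (Fin m)} (hL : L ∈ f.lines) (h : S ⊆ L) :
    f.Collinear S := .inr ⟨L, hL, h⟩

theorem coplanar_of_subset_plane {H : Finset (Fin m)} (hH : H ∈ f.planes) (h : S ⊆ H) :
    f.Coplanar S := .inr ⟨H, hH, h⟩

theorem plane_not_collinear {H : Finset (Fin m)} (hH : H ∈ f.planes) : ¬ f.Collinear H := by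
  rintro (h | ⟨L, hL, h⟩)
  · have := (f.plane_noncollinear H hH).1; omega
  · exact (f.plane_noncollinear H hH).2 L hL h

/-- A noncollinear set contains a noncollinear triple. -/
theorem exists_triple (h : ¬ f.Collinear S) : ∃ a ∈ S, ∃ b ∈ S, ∃ c ∈ S, a ≠ b ∧ a ≠ c ∧ b ≠ c ∧
    ¬ ∃ L ∈ f.lines, a ∈ L ∧ b ∈ L ∧ c ∈ L := by
  have h1 : 1 < S.card := by
    by_contra h1
    exact h (.inl (by omega))
  obtain ⟨a, ha, b, hb, hab⟩ := Finset.one_lt_card.1 h1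
  obtain ⟨L, ⟨hL, haL, hbL⟩, -⟩ := f.existsUnique_line a b hab
  have h2 : ¬ S ⊆ L := fun h2 => h (.inr ⟨L, hL, h2⟩)
  obtain ⟨c, hc, hcL⟩ := Finset.not_subset.1 h2
  refine ⟨a, ha, b, hb, c, hc, hab, fun e => hcL (e ▸ haL), fun e => hcL (e ▸ hbL), ?_⟩
  rintro ⟨L', hL', h1, h2, h3⟩
  exact hcL (line_eq hL hL' hab haL hbL h1 h2 ▸ h3)

theorem plane_eq_of_not_collinear {H K : Finset (Fin m)} (hH : H ∈ f.planes) (hK : K ∈ f.planes)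
    (hS : ¬ f.Collinear S) (h1 : S ⊆ H) (h2 : S ⊆ K) : H = K := by
  obtain ⟨a, ha, b, hb, c, hc, hab, hac, hbc, hn⟩ := exists_triple hS
  exact (f.existsUnique_plane a b c hab hac hbc hn).unique ⟨hH, h1 ha, h1 hb, h1 hc⟩
    ⟨hK, h2 ha, h2 hb, h2 hc⟩

/-- Two points of a line determine it, so lines are the sets of rank 2 that no further point
extends. With the analogue for planes, all data can be recovered from ranks, which is why deletions,
degenerations and realizations are described by ranks only. -/
theorem mem_lines_iff {L : Finset (Fin m)} : L ∈ f.lines ↔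
    f.rank L = 2 ∧ ∀ x, f.rank (insert x L) = 2 → x ∈ L := by
  simp only [rank_eq_two_iff]
  constructor
  · intro hL
    refine ⟨⟨collinear_of_subset_line hL subset_rfl, f.two_le_card_line L hL⟩, fun x hx => ?_⟩
    obtain ⟨a, ha, b, hb, hab⟩ := Finset.one_lt_card.1 (f.two_le_card_line L hL)
    rcases hx.1 with h | ⟨L', hL', h⟩
    · omega
    · rw [line_eq hL hL' hab ha hb (h (by simp [ha])) (h (by simp [hb]))]
      exact h (by simp)
  · rintro ⟨⟨h | ⟨L', hL', h⟩, h2⟩, h'⟩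
    · omega
    · have : L = L' := h.antisymm fun x hx => h' x
        ⟨collinear_of_subset_line hL' (Finset.insert_subset hx h),
          h2.trans (Finset.card_le_card (Finset.subset_insert _ _))⟩
      rwa [this]

theorem mem_planes_iff {H : Finset (Fin m)} : H ∈ f.planes ↔
    f.rank H = 3 ∧ ∀ x, f.rank (insert x H) = 3 → x ∈ H := by
  simp only [rank_eq_three_iff]
  constructor
  · intro hH
    refine ⟨⟨coplanar_of_subset_plane hH subset_rfl, plane_not_collinear hH⟩, fun x hx => ?_⟩
    rcases hx.1 with h | ⟨K, hK, h⟩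
    · exact absurd h hx.2
    · rw [plane_eq_of_not_collinear hH hK (plane_not_collinear hH) subset_rfl
        ((Finset.subset_insert _ _).trans h)]
      exact h (by simp)
  · rintro ⟨⟨h | ⟨K, hK, h⟩, h2⟩, h'⟩
    · exact absurd h h2
    · have : H = K := h.antisymm fun x hx => h' x
        ⟨coplanar_of_subset_plane hK (Finset.insert_subset hx h),
          fun h3 => h2 (h3.subset (Finset.subset_insert _ _))⟩
      rwa [this]

theorem rank_injective : Function.Injective (rank : PlanarSpace m → Finset (Fin m) → ℕ) := by
  intro f g h
  ext S
  · rw [mem_lines_iff, mem_lines_iff, h]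
  · rw [mem_planes_iff, mem_planes_iff, h]

theorem degenerates_self (f : PlanarSpace m) (P : Fin m) : f.Degenerates P f :=
  ⟨fun _ _ => rfl, fun _ h => h.2.1, fun _ => le_rfl⟩

/-! ### Points that violate the index condition are located. -/

section Reducible

variable {P : Fin m}

/-- The flats through `P` that are spanned by points other than `P`. -/
def IsFlat (f : PlanarSpace m) (P : Fin m) (C : Finset (Fin m)) : Prop :=
  (C ∈ f.lines ∧ P ∈ C ∧ 3 ≤ C.card) ∨
    (C ∈ f.planes ∧ (P ∈ C ∧ 4 ≤ C.card) ∧ ¬ f.Collinear (C.erase P))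

theorem IsFlat.spans {C : Finset (Fin m)} (h : f.IsFlat P C) : f.Spans P (C.erase P) := by
  refine ⟨Finset.notMem_erase _ _, ?_⟩
  rcases h with ⟨hC, hP, hc⟩ | ⟨hC, ⟨hP, hc⟩, hn⟩
  · have h1 : f.rank C = 2 := (mem_lines_iff.1 hC).1
    have h2 : f.rank (C.erase P) = 2 := rank_eq_two_iff.2
      ⟨collinear_of_subset_line hC (Finset.erase_subset _ _), by
        rw [Finset.card_erase_of_mem hP]; omega⟩
    rw [Finset.insert_erase hP, h1, h2]; simp
  · have h1 : f.rank C = 3 := (mem_planes_iff.1 hC).1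
    have h2 : f.rank (C.erase P) = 3 := rank_eq_three_iff.2
      ⟨coplanar_of_subset_plane hC (Finset.erase_subset _ _), hn⟩
    rw [Finset.insert_erase hP, h1, h2]; simp

/-- Adding a point to a set with at most one point raises the rank, so S has rank 2 or 3, and the
flat is the line or plane containing P and S. It is full because P is not in S. -/
theorem Spans.exists_isFlat (h : f.Spans P S) :
    ∃ C, f.IsFlat P C ∧ S ⊆ C ∧ f.rank C = f.rank S := by
  obtain ⟨hP, h1, h2⟩ := h
  have hc : (insert P S).card = S.card + 1 := Finset.card_insert_of_notMem hP
  have h3 : 1 < S.card := by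
    by_contra h3
    rw [rank_of_card_le_one (S := S) (by omega)] at h1
    have h4 := rank_le_one_iff.1 (h1.trans_le (by omega))
    rw [rank_of_card_le_one h4] at h1
    omega
  have h4 := @two_le_rank m f S h3
  have h5 := @rank_le_four m f S
  have h6 : f.rank S = 2 ∨ f.rank S = 3 := by omega
  rcases h6 with h6 | h6
  · rcases (rank_eq_two_iff.1 (h1.trans h6)).1 with h7 | ⟨L, hL, h7⟩
    · omega
    · have := Finset.card_le_card h7
      exact ⟨L, .inl ⟨hL, h7 (by simp), by omega⟩, (Finset.subset_insert _ _).trans h7,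
        by rw [h6, (mem_lines_iff.1 hL).1]⟩
  · have hn := (rank_eq_three_iff.1 h6).2
    obtain ⟨h7, h8⟩ := rank_eq_three_iff.1 (h1.trans h6)
    rcases h7 with h7 | ⟨H, hH, h7⟩
    · exact absurd h7 h8
    · have := Finset.card_le_card h7
      have h10 : S ⊆ H := (Finset.subset_insert _ _).trans h7
      have h9 : S ⊆ H.erase P := fun x hx =>
        Finset.mem_erase.2 ⟨fun e => hP (e ▸ hx), h10 hx⟩
      have h11 : 3 ≤ S.card := by
        obtain ⟨a, ha, b, hb, c, hc, hab, hac, hbc, -⟩ := exists_triple hn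
        exact (Finset.two_lt_card).2 ⟨a, ha, b, hb, c, hc, hab, hac, hbc⟩
      exact ⟨H, .inr ⟨hH, ⟨h7 (by simp), by omega⟩, fun h => hn (h.subset h9)⟩, h10,
        by rw [h6, (mem_planes_iff.1 hH).1]⟩

/-- A spanning set lies in a flat C of the same rank. If C contains A or B, adding that flat without
P cannot raise the rank. The problem thus becomes one of inclusions between full lines and planes.
-/
theorem exists_located_of_flats
    (h : (∀ C, ¬ f.IsFlat P C) ∨ ∃ A B, f.IsFlat P A ∧ f.IsFlat P B ∧
      ∀ C, f.IsFlat P C → A ⊆ C ∨ B ⊆ C) : ∃ d, f.Located P d := by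
  rcases h with h | ⟨A, B, hA, hB, h⟩
  · refine ⟨4, .inl ⟨rfl, fun S hS => ?_⟩⟩
    obtain ⟨C, hC, -⟩ := hS.exists_isFlat
    exact h C hC
  · refine ⟨_, .inr ⟨A.erase P, B.erase P, hA.spans, hB.spans, fun S hS => ?_, rfl⟩⟩
    obtain ⟨C, hC, hSC, hr⟩ := hS.exists_isFlat
    have key : ∀ D : Finset (Fin m), D ⊆ C → f.rank (S ∪ D.erase P) = f.rank S := fun D hD =>
      le_antisymm (hr ▸ rank_mono (Finset.union_subset hSC ((Finset.erase_subset _ _).trans hD)))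
        (rank_mono Finset.subset_union_left)
    exact (h C hC).imp (key A) (key B)

/-- This is not an axiom of planar spaces here. It is `ClosureMono` applied to the pair {a, b}
inside H: a point spanned by the pair is spanned by H. -/
theorem ClosureMono.line_subset_plane (hf : f.ClosureMono) {L H : Finset (Fin m)}
    (hL : L ∈ f.lines) (hH : H ∈ f.planes) {a b : Fin m} (hab : a ≠ b) (ha : a ∈ L) (hb : b ∈ L)
    (ha' : a ∈ H) (hb' : b ∈ H) : L ⊆ H := by
  intro x hx
  have h2 : f.rank {a, b} = 2 := rank_eq_two_iff.2
    ⟨collinear_of_subset_line hL (by simp [Finset.insert_subset_iff, ha, hb]),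
      (Finset.card_pair hab).ge⟩
  have h3 : f.rank (insert x {a, b}) = 2 := rank_eq_two_iff.2
    ⟨collinear_of_subset_line hL (by simp [Finset.insert_subset_iff, ha, hb, hx]),
      (Finset.card_pair hab).ge.trans (Finset.card_le_card (Finset.subset_insert _ _))⟩
  have h4 := hf {a, b} H (by simp [Finset.insert_subset_iff, ha', hb']) x (by rw [h2, h3])
  obtain ⟨h5, h6⟩ := mem_planes_iff.1 hH
  exact h6 x (h4.trans h5)

theorem not_collinear_insert {L : Finset (Fin m)} (hL : L ∈ f.lines) {R : Fin m} (hR : R ∉ L) :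
    ¬ f.Collinear (insert R L) := fun h => by
  refine hR ((mem_lines_iff.1 hL).2 R (rank_eq_two_iff.2 ⟨h, ?_⟩))
  exact (f.two_le_card_line L hL).trans (Finset.card_le_card (Finset.subset_insert _ _))

/-- The plane spanned by a line and a point. -/
theorem ClosureMono.exists_plane (hf : f.ClosureMono) {L : Finset (Fin m)} (hL : L ∈ f.lines)
    {R : Fin m} (hR : R ∉ L) : ∃ K ∈ f.planes, R ∈ K ∧ L ⊆ K ∧ L.card < K.card := by
  obtain ⟨a, ha, b, hb, hab⟩ := Finset.one_lt_card.1 (f.two_le_card_line L hL)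
  obtain ⟨K, ⟨hK, ha', hb', hR'⟩, -⟩ := f.existsUnique_plane a b R hab (fun e => hR (e ▸ ha))
    (fun e => hR (e ▸ hb)) (by
      rintro ⟨L', hL', h1, h2, h3⟩
      exact hR (line_eq hL hL' hab ha hb h1 h2 ▸ h3))
  have h := hf.line_subset_plane hL hK hab ha hb ha' hb'
  exact ⟨K, hK, hR', h, Finset.card_lt_card ⟨h, fun h' => hR (h' hR')⟩⟩

theorem four_le_planeIndex {H₁ H₂ H₃ H₄ : Finset (Fin m)}
    (h₁ : H₁ ∈ f.planes ∧ P ∈ H₁ ∧ 4 ≤ H₁.card) (h₂ : H₂ ∈ f.planes ∧ P ∈ H₂ ∧ 4 ≤ H₂.card)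
    (h₃ : H₃ ∈ f.planes ∧ P ∈ H₃ ∧ 4 ≤ H₃.card) (h₄ : H₄ ∈ f.planes ∧ P ∈ H₄ ∧ 4 ≤ H₄.card)
    (h12 : H₁ ≠ H₂) (h13 : H₁ ≠ H₃) (h14 : H₁ ≠ H₄) (h23 : H₂ ≠ H₃) (h24 : H₂ ≠ H₄)
    (h34 : H₃ ≠ H₄) : 4 ≤ f.planeIndex P := by
  have hc : ({H₁, H₂, H₃, H₄} : Finset (Finset (Fin m))).card = 4 := by
    rw [Finset.card_insert_of_notMem (by simp [*]), Finset.card_insert_of_notMem (by simp [*]),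
      Finset.card_pair h34]
  rw [← hc]
  refine Finset.card_le_card fun H hH => ?_
  simp only [Finset.mem_insert, Finset.mem_singleton] at hH
  rw [Finset.mem_filter]
  rcases hH with rfl | rfl | rfl | rfl <;> assumption

/-- A point that violates the index condition of hyperfigurations can be located. -/
theorem ClosureMono.exists_located (hf : f.ClosureMono)
    (hP : ¬ (4 ≤ f.planeIndex P ∨ 3 ≤ f.lineIndex P ∨ (f.planeIndex P = 3 ∧ f.lineIndex P = 0))) :
    ∃ d, f.Located P d := by
  apply exists_located_of_flats
  push Not at hP
  obtain ⟨hi, hj, hij⟩ := hP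
  have hmem : ∀ L, L ∈ f.lines.filter (fun L => P ∈ L ∧ 3 ≤ L.card) ↔
      L ∈ f.lines ∧ P ∈ L ∧ 3 ≤ L.card := fun L => Finset.mem_filter
  have hcases : f.lineIndex P = 0 ∨ f.lineIndex P = 1 ∨ f.lineIndex P = 2 := by omega
  rcases hcases with h0 | h1 | h2
  -- The index pair (3, 0) is excluded by hypothesis, so at most two full planes remain.
  · have hi2 : f.planeIndex P ≤ 2 := by
      have := fun h => hij h h0
      omega
    have hL : ∀ C, f.IsFlat P C → C ∈ f.planes ∧ P ∈ C ∧ 4 ≤ C.card := by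
      rintro C (h | h)
      · rw [lineIndex, Finset.card_eq_zero] at h0
        exact absurd ((hmem C).2 h) (by simp [h0])
      · exact ⟨h.1, h.2.1⟩
    by_cases hne : ∃ A, f.IsFlat P A
    · right
      obtain ⟨A, hA⟩ := hne
      by_cases hB : ∃ B, f.IsFlat P B ∧ B ≠ A
      · obtain ⟨B, hB, hBA⟩ := hB
        refine ⟨A, B, hA, hB, fun C hC => ?_⟩
        by_contra! hcon
        have hc : ({A, B, C} : Finset (Finset (Fin m))).card = 3 :=
          Finset.card_eq_three.2 ⟨A, B, C, hBA.symm, fun e => hcon.1 (e ▸ subset_rfl),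
            fun e => hcon.2 (e ▸ subset_rfl), rfl⟩
        have : ({A, B, C} : Finset (Finset (Fin m))).card ≤ f.planeIndex P := by
          refine Finset.card_le_card fun H hH => ?_
          simp only [Finset.mem_insert, Finset.mem_singleton] at hH
          rw [Finset.mem_filter]
          rcases hH with rfl | rfl | rfl
          exacts [hL _ hA, hL _ hB, hL _ hC]
        omega
      · push Not at hB
        -- A single flat is used twice; the formula then gives d = rank A.
        exact ⟨A, A, hA, hA, fun C hC => .inl (hB C hC).ge⟩
    · exact .inl (not_exists.1 hne)
  · obtain ⟨L, hL⟩ := Finset.card_eq_one.1 h1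
    have hLm := (hmem L).1 (by simp [hL])
    have huniq : ∀ L', L' ∈ f.lines ∧ P ∈ L' ∧ 3 ≤ L'.card → L' = L := fun L' h => by
      simpa [hL] using (hmem L').2 h
    right
    by_cases hB : ∃ H, f.IsFlat P H ∧ ¬ L ⊆ H
    · obtain ⟨H₁, hH₁, hLH₁⟩ := hB
      -- Otherwise H₁ and H₂ are distinct full planes not containing L. A point of H₁ outside L
      -- spans with L a plane K₁, and a point of H₁ outside K₁ spans with L another plane K₂. Both
      -- are full, since they have more points than L, so P would lie on four full planes.
      refine ⟨L, H₁, .inl hLm, hH₁, fun H₂ hH₂ => ?_⟩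
      by_contra! hcon
      obtain ⟨hLH₂, hne⟩ := hcon
      have hH₁' : H₁ ∈ f.planes ∧ P ∈ H₁ ∧ 4 ≤ H₁.card := by
        rcases hH₁ with h | h
        · exact absurd (huniq _ h).ge hLH₁
        · exact ⟨h.1, h.2.1⟩
      have hH₂' : H₂ ∈ f.planes ∧ P ∈ H₂ ∧ 4 ≤ H₂.card := by
        rcases hH₂ with h | h
        · exact absurd (huniq _ h).ge hLH₂
        · exact ⟨h.1, h.2.1⟩
      obtain ⟨R₁, hR₁, hR₁L⟩ := Finset.not_subset.1 ((f.plane_noncollinear H₁ hH₁'.1).2 L hLm.1)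
      obtain ⟨K₁, hK₁, hRK₁, hLK₁, hc₁⟩ := hf.exists_plane hLm.1 hR₁L
      have hHK : ¬ H₁ ⊆ K₁ := fun h => hLH₁ (plane_eq_of_not_collinear hH₁'.1 hK₁
        (plane_not_collinear hH₁'.1) subset_rfl h ▸ hLK₁)
      obtain ⟨R₂, hR₂, hR₂K⟩ := Finset.not_subset.1 hHK
      obtain ⟨K₂, hK₂, hRK₂, hLK₂, hc₂⟩ := hf.exists_plane hLm.1 fun h => hR₂K (hLK₁ h)
      have := four_le_planeIndex hH₁' hH₂' (H₃ := K₁) (H₄ := K₂) ⟨hK₁, hLK₁ hLm.2.1, by omega⟩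
        ⟨hK₂, hLK₂ hLm.2.1, by omega⟩ (fun e => hne (e ▸ subset_rfl)) (fun e => hLH₁ (e ▸ hLK₁))
        (fun e => hLH₁ (e ▸ hLK₂)) (fun e => hLH₂ (e ▸ hLK₁)) (fun e => hLH₂ (e ▸ hLK₂))
        (fun e => hR₂K (e ▸ hRK₂))
      omega
    · push Not at hB
      exact ⟨L, L, .inl hLm, .inl hLm, fun C hC => .inl (hB C hC)⟩
  · obtain ⟨L₁, L₂, h12, hL⟩ := Finset.card_eq_two.1 h2
    have hLm₁ := (hmem L₁).1 (by simp [hL])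
    have hLm₂ := (hmem L₂).1 (by simp [hL])
    have huniq : ∀ L', L' ∈ f.lines ∧ P ∈ L' ∧ 3 ≤ L'.card → L' = L₁ ∨ L' = L₂ := fun L' h => by
      simpa [hL] using (hmem L').2 h
    right
    -- Otherwise take the plane K of L₁ and L₂ and a point R of H outside K. The planes K₁ and K₂
    -- joining R to the two lines differ, as a plane containing both lines is K. So H, K, K₁, K₂ are
    -- four full planes.
    refine ⟨L₁, L₂, .inl hLm₁, .inl hLm₂, fun H hH => ?_⟩
    by_contra! hcon
    have hH' : H ∈ f.planes ∧ P ∈ H ∧ 4 ≤ H.card := by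
      rcases hH with h | h
      · rcases huniq _ h with rfl | rfl
        · exact absurd subset_rfl hcon.1
        · exact absurd subset_rfl hcon.2
      · exact ⟨h.1, h.2.1⟩
    obtain ⟨b, hb, hbP⟩ : ∃ b ∈ L₂, b ≠ P := Finset.exists_mem_ne (by omega) P
    have hbL₁ : b ∉ L₁ := fun h => h12 (line_eq hLm₁.1 hLm₂.1 hbP h hLm₁.2.1 hb hLm₂.2.1)
    obtain ⟨K, hK, hbK, hL₁K, hcK⟩ := hf.exists_plane hLm₁.1 hbL₁
    have hL₂K : L₂ ⊆ K := hf.line_subset_plane hLm₂.1 hK hbP hb hLm₂.2.1 hbK (hL₁K hLm₁.2.1)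
    have hHK : ¬ H ⊆ K := fun h => hcon.1 (plane_eq_of_not_collinear hH'.1 hK
        (plane_not_collinear hH'.1) subset_rfl h ▸ hL₁K)
    obtain ⟨R, hR, hRK⟩ := Finset.not_subset.1 hHK
    obtain ⟨K₁, hK₁, hRK₁, hLK₁, hc₁⟩ := hf.exists_plane hLm₁.1 fun h => hRK (hL₁K h)
    obtain ⟨K₂, hK₂, hRK₂, hLK₂, hc₂⟩ := hf.exists_plane hLm₂.1 fun h => hRK (hL₂K h)
    have := four_le_planeIndex (P := P) hH' (H₂ := K) (H₃ := K₁) (H₄ := K₂)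
      ⟨hK, hL₁K hLm₁.2.1, by omega⟩ ⟨hK₁, hLK₁ hLm₁.2.1, by omega⟩ ⟨hK₂, hLK₂ hLm₂.2.1, by omega⟩
      (fun e => hcon.1 (e ▸ hL₁K)) (fun e => hcon.1 (e ▸ hLK₁)) (fun e => hcon.2 (e ▸ hLK₂))
      (fun e => hRK (e ▸ hRK₁)) (fun e => hRK (e ▸ hRK₂)) (fun e => by
        refine hRK ?_
        rw [← plane_eq_of_not_collinear hK₁ hK (not_collinear_insert hLm₁.1 hbL₁)
          (Finset.insert_subset (e ▸ hLK₂ hb) hLK₁) (Finset.insert_subset hbK hL₁K)]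
        exact hRK₁)
    omega

end Reducible

end PlanarSpace

/-! ### Ranks of families of points in projective 3-space. -/

section Span

variable {F : Type u} [Field F] {m : ℕ}

/-- The vector subspace spanned by the points `σ i` with `i ∈ S`. -/
noncomputable def pointSpan (σ : Fin m → P3 F) (S : Finset (Fin m)) :
    Submodule F (Fin 4 → F) :=
  Submodule.span F ((fun i => (σ i).rep) '' (S : Set (Fin m)))

/-- The dimension of the vector subspace spanned by the points `σ i` with `i ∈ S`. -/
noncomputable def pointRank (σ : Fin m → P3 F) (S : Finset (Fin m)) : ℕ :=
  Module.finrank F (pointSpan σ S)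

theorem submodule_le_iff_rep_mem (x : P3 F) (W : Submodule F (Fin 4 → F)) :
    x.submodule ≤ W ↔ x.rep ∈ W := by
  rw [Projectivization.submodule_eq, Submodule.span_singleton_le_iff_mem]

variable {σ : Fin m → P3 F} {S T : Finset (Fin m)}

theorem pointSpan_le_iff {W : Submodule F (Fin 4 → F)} :
    pointSpan σ S ≤ W ↔ ∀ i ∈ S, (σ i).rep ∈ W := by
  rw [pointSpan, Submodule.span_le, Set.image_subset_iff]; rfl

theorem rep_mem_pointSpan {i : Fin m} (h : i ∈ S) : (σ i).rep ∈ pointSpan σ S :=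
  Submodule.subset_span ⟨i, h, rfl⟩

theorem pointSpan_mono (h : S ⊆ T) : pointSpan σ S ≤ pointSpan σ T :=
  pointSpan_le_iff.2 fun _ hi => rep_mem_pointSpan (h hi)

theorem pointSpan_insert (i : Fin m) :
    pointSpan σ (insert i S) = Submodule.span F {(σ i).rep} ⊔ pointSpan σ S := by
  rw [pointSpan, Finset.coe_insert, Set.image_insert_eq, Submodule.span_insert]; rfl

theorem pointSpan_union : pointSpan σ (S ∪ T) = pointSpan σ S ⊔ pointSpan σ T := by
  rw [pointSpan, Finset.coe_union, Set.image_union, Submodule.span_union]; rfl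

theorem pointRank_mono (h : S ⊆ T) : pointRank σ S ≤ pointRank σ T :=
  Submodule.finrank_mono (pointSpan_mono h)

theorem pointRank_le_four : pointRank σ S ≤ 4 := by
  have h := (pointSpan σ S).finrank_le
  rwa [Module.finrank_fin_fun] at h

theorem pointRank_insert_le (i : Fin m) : pointRank σ (insert i S) ≤ pointRank σ S + 1 := by
  rw [pointRank, pointSpan_insert]
  have h1 := Submodule.finrank_add_le_finrank_add_finrank (Submodule.span F {(σ i).rep})
    (pointSpan σ S)
  have h2 := finrank_span_singleton (K := F) (σ i).rep_nonzero
  rw [pointRank]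
  omega

theorem pointSpan_eq_of_pointRank_le (h : S ⊆ T) (h' : pointRank σ T ≤ pointRank σ S) :
    pointSpan σ S = pointSpan σ T :=
  Submodule.eq_of_le_of_finrank_le (pointSpan_mono h) h'

theorem rep_mem_pointSpan_iff {i : Fin m} :
    (σ i).rep ∈ pointSpan σ S ↔ pointRank σ (insert i S) = pointRank σ S := by
  constructor
  · intro h
    rw [pointRank, pointSpan_insert, sup_eq_right.2]
    · rfl
    · rwa [Submodule.span_singleton_le_iff_mem]
  · intro h
    rw [pointSpan_eq_of_pointRank_le (Finset.subset_insert i S) h.le]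
    exact rep_mem_pointSpan (Finset.mem_insert_self _ _)

theorem pointRank_empty : pointRank σ ∅ = 0 := by
  rw [pointRank, pointSpan, Finset.coe_empty, Set.image_empty, Submodule.span_empty, finrank_bot]

theorem pointRank_singleton (i : Fin m) : pointRank σ {i} = 1 := by
  rw [pointRank, pointSpan, Finset.coe_singleton, Set.image_singleton]
  exact finrank_span_singleton (σ i).rep_nonzero

theorem pointRank_le_card : pointRank σ S ≤ S.card := by
  induction S using Finset.induction_on with
  | empty => simp [pointRank_empty]
  | insert a s ha ih =>
    rw [Finset.card_insert_of_notMem ha]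
    exact (pointRank_insert_le a).trans (by omega)

theorem rep_mem_span_singleton_iff {x y : P3 F} :
    x.rep ∈ Submodule.span F {y.rep} ↔ x = y := by
  constructor
  · intro h
    rw [Submodule.mem_span_singleton] at h
    obtain ⟨a, ha⟩ := h
    rw [← x.mk_rep, ← y.mk_rep, Projectivization.mk_eq_mk_iff']
    exact ⟨a, ha⟩
  · rintro rfl
    exact Submodule.mem_span_singleton_self _

theorem pointRank_pair_iff {a b : Fin m} : pointRank σ {a, b} = 2 ↔ σ a ≠ σ b := by
  have h1 := pointRank_insert_le (σ := σ) (S := {b}) a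
  have h2 := pointRank_mono (σ := σ) (Finset.subset_insert a {b})
  have h3 := rep_mem_pointSpan_iff (σ := σ) (i := a) (S := {b})
  rw [pointRank_singleton] at h1 h2 h3
  rw [pointSpan, Finset.coe_singleton, Set.image_singleton, rep_mem_span_singleton_iff] at h3
  rw [ne_eq, h3]
  omega

theorem two_le_pointRank (hσ : Function.Injective σ) {a b : Fin m} (hab : a ≠ b) (ha : a ∈ S)
    (hb : b ∈ S) : 2 ≤ pointRank σ S := by
  rw [← pointRank_pair_iff.2 (hσ.ne hab)]
  exact pointRank_mono (by simp [Finset.insert_subset_iff, ha, hb])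

/-- `ContainedInFlat` asks for a subspace of exact dimension, so a smaller span is enlarged by one
vector at a time. -/
theorem exists_le_finrank_eq (W : Submodule F (Fin 4 → F)) {d : ℕ}
    (h : Module.finrank F W ≤ d) (hd : d ≤ 4) : ∃ W', W ≤ W' ∧ Module.finrank F W' = d := by
  induction d with
  | zero => exact ⟨W, le_rfl, by omega⟩
  | succ d ih =>
    rcases h.lt_or_eq with h | h
    · obtain ⟨W', hW, hW'⟩ := ih (by omega) (by omega)
      have hne : W' ≠ ⊤ := by
        rintro rfl
        simp at hW'
        omega
      obtain ⟨v, -, hv⟩ := SetLike.exists_of_lt hne.lt_top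
      have hlt : W' < W' ⊔ Submodule.span F {v} :=
        left_lt_sup.2 fun h => hv (h (Submodule.mem_span_singleton_self v))
      have h1 := Submodule.finrank_lt_finrank_of_lt hlt
      have h2 := Submodule.finrank_add_le_finrank_add_finrank W' (Submodule.span F {v})
      have h3 := finrank_span_singleton (K := F) (v := v) (fun e => hv (e ▸ W'.zero_mem))
      exact ⟨W' ⊔ Submodule.span F {v}, hW.trans le_sup_left, by omega⟩
    · exact ⟨W, le_rfl, h⟩

theorem containedInFlat_image_iff {d : ℕ} (hd : d ≤ 3) :
    ContainedInFlat d (σ '' (S : Set (Fin m))) ↔ pointRank σ S ≤ d + 1 := by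
  constructor
  · rintro ⟨W, hW, h⟩
    rw [← hW]
    refine Submodule.finrank_mono (pointSpan_le_iff.2 fun i hi => ?_)
    rw [← submodule_le_iff_rep_mem]
    exact h _ ⟨i, hi, rfl⟩
  · intro h
    obtain ⟨W, hW, hd⟩ := exists_le_finrank_eq _ h (by omega)
    refine ⟨W, hd, ?_⟩
    rintro _ ⟨i, hi, rfl⟩
    rw [submodule_le_iff_rep_mem]
    exact hW (rep_mem_pointSpan hi)

end Span

/-! ### Strong realizations as rank-preserving families. -/

namespace PlanarSpace

variable {F : Type u} [Field F] {m : ℕ}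

/-- The conditions on lines and planes say that the thresholds 2 and 3 agree for both ranks. Below
them there is no freedom: sets with at most one point have rank equal to their size, and larger sets
have rank at least 2, by injectivity on the side of σ. -/
theorem isStrongRealization_iff {f : PlanarSpace m} {σ : Fin m → P3 F} :
    f.IsStrongRealization σ ↔ ∀ S, pointRank σ S = f.rank S := by
  constructor
  · intro h S
    by_cases hc : S.card ≤ 1
    · rw [rank_of_card_le_one hc]
      interval_cases h : S.card
      · rw [Finset.card_eq_zero] at h
        rw [h, pointRank_empty]
      · obtain ⟨a, rfl⟩ := Finset.card_eq_one.1 h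
        exact pointRank_singleton a
    · obtain ⟨a, ha, b, hb, hab⟩ := Finset.one_lt_card.1 (not_le.1 hc)
      have h1 := two_le_pointRank h.injective hab ha hb
      have h2 := two_le_rank (f := f) (not_le.1 hc)
      have h3 := (containedInFlat_image_iff (by norm_num)).symm.trans (h.inLine_iff S)
      have h4 := (containedInFlat_image_iff (by norm_num)).symm.trans (h.inPlane_iff S)
      rw [← rank_le_two_iff] at h3
      rw [← rank_le_three_iff] at h4
      have h5 := pointRank_le_four (σ := σ) (S := S)
      have h6 := rank_le_four (f := f) (S := S)
      omega
  · intro h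
    refine ⟨fun a b hab => ?_, fun S => ?_, fun S => ?_⟩
    · by_contra hne
      refine pointRank_pair_iff.1 ?_ hab
      rw [h]
      have h1 := two_le_rank (f := f) (Finset.card_pair hne).ge
      have h2 := pointRank_le_card (σ := σ) (S := {a, b})
      rw [h, Finset.card_pair hne] at h2
      omega
    · rw [← rank_le_two_iff, ← h]
      exact containedInFlat_image_iff (by norm_num)
    · rw [← rank_le_three_iff, ← h]
      exact containedInFlat_image_iff (by norm_num)

theorem IsStrongRealization.unique {f g : PlanarSpace m} {σ : Fin m → P3 F}
    (hf : f.IsStrongRealization σ) (hg : g.IsStrongRealization σ) : f = g :=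
  rank_injective <| funext fun S =>
    (isStrongRealization_iff.1 hf S).symm.trans (isStrongRealization_iff.1 hg S)

/-- Spans of vectors are monotone. A planar space without this property therefore has realization
count 0 and can be discarded. -/
theorem IsStrongRealization.closureMono {f : PlanarSpace m} {σ : Fin m → P3 F}
    (h : f.IsStrongRealization σ) : f.ClosureMono := by
  rw [isStrongRealization_iff] at h
  intro S T hST x hx
  rw [← h, ← h, ← rep_mem_pointSpan_iff] at hx ⊢
  exact pointSpan_mono hST hx

open Classical in
/-- The points in the flat spanned by `S`. -/
noncomputable def pointClosure (σ : Fin m → P3 F) (S : Finset (Fin m)) : Finset (Fin m) :=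
  Finset.univ.filter fun i => (σ i).rep ∈ pointSpan σ S

section

variable {σ : Fin m → P3 F} {S T : Finset (Fin m)}

theorem mem_pointClosure {i : Fin m} : i ∈ pointClosure σ S ↔ (σ i).rep ∈ pointSpan σ S := by
  simp [pointClosure]

theorem subset_pointClosure : S ⊆ pointClosure σ S := fun _ hi =>
  mem_pointClosure.2 (rep_mem_pointSpan hi)

theorem pointSpan_pointClosure : pointSpan σ (pointClosure σ S) = pointSpan σ S :=
  le_antisymm (pointSpan_le_iff.2 fun _ hi => mem_pointClosure.1 hi)
    (pointSpan_mono subset_pointClosure)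

theorem pointRank_pointClosure : pointRank σ (pointClosure σ S) = pointRank σ S := by
  rw [pointRank, pointSpan_pointClosure, pointRank]

theorem subset_pointClosure_of_pointRank_le (h : S ⊆ T) (h' : pointRank σ T ≤ pointRank σ S) :
    T ⊆ pointClosure σ S := fun i hi => by
  rw [mem_pointClosure, pointSpan_eq_of_pointRank_le h h']
  exact rep_mem_pointSpan hi

/-- `C` is a flat of rank `k`. -/
def IsPointFlat (σ : Fin m → P3 F) (k : ℕ) (C : Finset (Fin m)) : Prop :=
  pointRank σ C = k ∧ pointClosure σ C = C

theorem isPointFlat_pointClosure : IsPointFlat σ (pointRank σ S) (pointClosure σ S) := by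
  refine ⟨pointRank_pointClosure, ?_⟩
  ext i
  rw [mem_pointClosure, pointSpan_pointClosure, ← mem_pointClosure]

theorem IsPointFlat.eq_pointClosure {C : Finset (Fin m)} (hC : IsPointFlat σ (pointRank σ S) C)
    (h : S ⊆ C) : C = pointClosure σ S := by
  refine (subset_pointClosure_of_pointRank_le h hC.1.le).antisymm fun i hi => ?_
  rw [← hC.2, mem_pointClosure]
  exact pointSpan_mono h (mem_pointClosure.1 hi)

end

open Classical in
/-- The planar space of an injective family of points. -/
theorem exists_isStrongRealization {σ : Fin m → P3 F} (hσ : Function.Injective σ) :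
    ∃ f : PlanarSpace m, f.IsStrongRealization σ := by
  have hex : ∀ S, 2 ≤ pointRank σ S → ∃ a ∈ S, ∃ b ∈ S, a ≠ b := fun S h =>
    Finset.one_lt_card.1 (h.trans pointRank_le_card)
  have hline : ∀ S, ∀ a ∈ S, ∀ b ∈ S, a ≠ b → pointRank σ S ≤ 2 → S ⊆ pointClosure σ {a, b} := by
    intro S a ha b hb hab h
    refine subset_pointClosure_of_pointRank_le (by simp [Finset.insert_subset_iff, ha, hb]) ?_
    rwa [pointRank_pair_iff.2 (hσ.ne hab)]
  let f : PlanarSpace m :=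
    { lines := Finset.univ.filter (IsPointFlat σ 2)
      planes := Finset.univ.filter (IsPointFlat σ 3)
      two_le_card_line := by
        intro L hL
        rw [Finset.mem_filter] at hL
        exact hL.2.1.ge.trans pointRank_le_card
      existsUnique_line := by
        intro a b hab
        have h2 := pointRank_pair_iff.2 (hσ.ne hab)
        refine ⟨pointClosure σ {a, b}, ⟨?_, subset_pointClosure (by simp),
          subset_pointClosure (by simp)⟩, ?_⟩
        · rw [Finset.mem_filter]
          exact ⟨Finset.mem_univ _, h2 ▸ isPointFlat_pointClosure⟩
        · rintro L ⟨hL, ha, hb⟩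
          rw [Finset.mem_filter, ← h2] at hL
          exact hL.2.eq_pointClosure (by simp [Finset.insert_subset_iff, ha, hb])
      existsUnique_plane := by
        intro a b c hab hac hbc hn
        have h3 : pointRank σ {a, b, c} = 3 := by
          have h1 := two_le_pointRank hσ (S := {a, b, c}) hab (by simp) (by simp)
          have h2 : pointRank σ {a, b, c} ≤ 3 := pointRank_le_card.trans Finset.card_le_three
          have h4 : pointRank σ {a, b, c} ≠ 2 := by
            intro h4
            refine hn ⟨pointClosure σ {a, b, c}, ?_, subset_pointClosure (by simp),
              subset_pointClosure (by simp), subset_pointClosure (by simp)⟩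
            rw [Finset.mem_filter]
            exact ⟨Finset.mem_univ _, h4 ▸ isPointFlat_pointClosure⟩
          omega
        refine ⟨pointClosure σ {a, b, c}, ⟨?_, subset_pointClosure (by simp),
          subset_pointClosure (by simp), subset_pointClosure (by simp)⟩, ?_⟩
        · rw [Finset.mem_filter]
          exact ⟨Finset.mem_univ _, h3 ▸ isPointFlat_pointClosure⟩
        · rintro L ⟨hL, ha, hb, hc⟩
          rw [Finset.mem_filter, ← h3] at hL
          exact hL.2.eq_pointClosure (by simp [Finset.insert_subset_iff, ha, hb, hc])
      plane_noncollinear := by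
        intro H hH
        rw [Finset.mem_filter] at hH
        refine ⟨hH.2.1.ge.trans pointRank_le_card, fun L hL h => ?_⟩
        rw [Finset.mem_filter] at hL
        have := pointRank_mono (σ := σ) h
        rw [hH.2.1, hL.2.1] at this
        omega }
  have hlines : ∀ L, L ∈ f.lines ↔ IsPointFlat σ 2 L := fun L => by simp [f]
  have hplanes : ∀ L, L ∈ f.planes ↔ IsPointFlat σ 3 L := fun L => by simp [f]
  have hcol : ∀ S, pointRank σ S ≤ 2 ↔ f.Collinear S := by
    intro S
    constructor
    · intro h
      by_cases hc : S.card ≤ 1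
      · exact .inl hc
      · obtain ⟨a, ha, b, hb, hab⟩ := Finset.one_lt_card.1 (not_le.1 hc)
        refine .inr ⟨_, ?_, hline S a ha b hb hab h⟩
        rw [hlines, ← pointRank_pair_iff.2 (hσ.ne hab)]
        exact isPointFlat_pointClosure
    · rintro (h | ⟨L, hL, h⟩)
      · exact pointRank_le_card.trans (by omega)
      · exact (pointRank_mono h).trans ((hlines L).1 hL).1.le
  refine ⟨f, hσ, fun S => ?_, fun S => ?_⟩
  · exact (containedInFlat_image_iff (by norm_num)).trans (hcol S)
  · refine (containedInFlat_image_iff (by norm_num)).trans ⟨fun h => ?_, ?_⟩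
    · by_cases h2 : pointRank σ S ≤ 2
      · exact .inl ((hcol S).1 h2)
      · refine .inr ⟨_, ?_, subset_pointClosure (σ := σ)⟩
        rw [hplanes, show 3 = pointRank σ S by omega]
        exact isPointFlat_pointClosure
    · rintro (h | ⟨L, hL, h⟩)
      · exact ((hcol S).2 h).trans (by norm_num)
      · exact (pointRank_mono h).trans ((hplanes L).1 hL).1.le

/-! ### Counting realizations, caps and points of flats. -/

section Counting

variable [Fintype F]

/-- By `IsStrongRealization.unique`, different planar spaces have disjoint sets of strong
realizations. -/
theorem sum_realizationCount (s : Finset (PlanarSpace m)) :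
    ∑ f ∈ s, f.realizationCount F =
      Nat.card {σ : Fin m → P3 F // ∃ f ∈ s, f.IsStrongRealization σ} := by
  classical
  have : Fintype (P3 F) := Fintype.ofFinite _
  simp only [realizationCount, Nat.card_eq_fintype_card, Fintype.card_subtype]
  rw [← Finset.card_biUnion]
  · congr 1
    ext σ
    simp
  · intro f _ g _ hfg
    rw [Function.onFun, Finset.disjoint_left]
    intro σ h1 h2
    simp only [Finset.mem_filter, Finset.mem_univ, true_and] at h1 h2
    exact hfg (h1.unique h2)

theorem capCount_eq_sum (n : ℕ) :
    capCount n F = ∑ f ∈ withoutFullLines n, f.realizationCount F := by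
  rw [sum_realizationCount, capCount]
  refine Nat.card_congr (Equiv.subtypeEquivRight fun σ => ?_)
  simp only [withoutFullLines, Finset.mem_filter, Finset.mem_univ, true_and]
  constructor
  · rintro ⟨hσ, hcap⟩
    obtain ⟨f, hf⟩ := exists_isStrongRealization hσ
    refine ⟨f, fun L hL => ?_, hf⟩
    by_contra! hc
    obtain ⟨a, ha, b, hb, c, hc, hab, hac, hbc⟩ := Finset.two_lt_card.1 hc
    refine hcap _ ⟨a, rfl⟩ _ ⟨b, rfl⟩ _ ⟨c, rfl⟩ (hσ.ne hab) (hσ.ne hac) (hσ.ne hbc) ?_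
    have := (hf.inLine_iff {a, b, c}).2
      (collinear_of_subset_line hL (by simp [Finset.insert_subset_iff, ha, hb, hc]))
    simpa [Set.image_insert_eq] using this
  · rintro ⟨f, hL, hf⟩
    refine ⟨hf.injective, ?_⟩
    rintro _ ⟨a, rfl⟩ _ ⟨b, rfl⟩ _ ⟨c, rfl⟩ hab hac hbc h
    have h1 := (hf.inLine_iff {a, b, c}).1 (by simpa [Set.image_insert_eq] using h)
    have h2 : ({a, b, c} : Finset (Fin n)).card = 3 := Finset.card_eq_three.2
      ⟨a, b, c, fun e => hab (e ▸ rfl), fun e => hac (e ▸ rfl), fun e => hbc (e ▸ rfl), rfl⟩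
    rcases h1 with h1 | ⟨L, hL', h1⟩
    · omega
    · have := Finset.card_le_card h1
      have := hL L hL'
      omega

theorem card_points_eq (W : Submodule F (Fin 4 → F)) :
    Nat.card {x : P3 F // x.rep ∈ W} =
      ∑ i ∈ Finset.range (Module.finrank F W), Fintype.card F ^ i := by
  rw [← Nat.card_eq_fintype_card, ← Projectivization.card_of_finrank F W rfl]
  symm
  have hmem : ∀ y : Projectivization F W,
      (Projectivization.map W.subtype W.injective_subtype y).rep ∈ W := by
    intro y
    induction y using Projectivization.ind with | h v hv =>
    rw [Projectivization.map_mk, ← submodule_le_iff_rep_mem, Projectivization.submodule_mk,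
      Submodule.span_singleton_le_iff_mem]
    exact v.2
  refine Nat.card_congr (Equiv.ofBijective (fun y => ⟨_, hmem y⟩) ⟨fun y z h => ?_, ?_⟩)
  · exact Projectivization.map_injective W.subtype W.injective_subtype (congrArg Subtype.val h)
  · rintro ⟨x, hx⟩
    refine ⟨Projectivization.mk F ⟨x.rep, hx⟩ fun h => x.rep_nonzero (congrArg Subtype.val h), ?_⟩
    refine Subtype.ext ?_
    exact (Projectivization.map_mk _ W.injective_subtype _ _).trans x.mk_rep

end Counting

end PlanarSpace

/-! ### Deleting a point and counting its possible positions. -/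

namespace PlanarSpace

variable {F : Type u} [Field F] {m : ℕ}

theorem exists_map_succAbove {P : Fin (m + 1)} {S : Finset (Fin (m + 1))} (h : P ∉ S) :
    ∃ T : Finset (Fin m), S = T.map P.succAboveEmb := by
  refine ⟨Finset.univ.filter fun i => P.succAbove i ∈ S, ?_⟩
  ext x
  simp only [Finset.mem_map, Finset.mem_filter, Finset.mem_univ, true_and, Fin.coe_succAboveEmb]
  constructor
  · intro hx
    obtain ⟨i, rfl⟩ := Fin.exists_succAbove_eq (x := x) (y := P) fun e => h (e ▸ hx)
    exact ⟨i, hx, rfl⟩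
  · rintro ⟨i, hi, rfl⟩
    exact hi

theorem notMem_map_succAbove {P : Fin (m + 1)} {T : Finset (Fin m)} :
    P ∉ T.map P.succAboveEmb := by
  simp [Fin.succAbove_ne]

theorem pointSpan_map {σ : Fin (m + 1) → P3 F} {P : Fin (m + 1)} {T : Finset (Fin m)} :
    pointSpan σ (T.map P.succAboveEmb) = pointSpan (P.removeNth σ) T := by
  rw [pointSpan, pointSpan, Finset.coe_map, Set.image_image]
  rfl

theorem pointRank_map {σ : Fin (m + 1) → P3 F} {P : Fin (m + 1)} {T : Finset (Fin m)} :
    pointRank σ (T.map P.succAboveEmb) = pointRank (P.removeNth σ) T := by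
  rw [pointRank, pointSpan_map, pointRank]

/-- The intersection of the flats through `P` that are spanned by other points. -/
noncomputable def constraintSpan (f : PlanarSpace (m + 1)) (P : Fin (m + 1)) (σ : Fin m → P3 F) :
    Submodule F (Fin 4 → F) :=
  ⨅ S : {S : Finset (Fin m) // f.Spans P (S.map P.succAboveEmb)}, pointSpan σ S

/-- `σ` is a strong realization of `f` with `P` deleted. -/
def RealizesDeletion (f : PlanarSpace (m + 1)) (P : Fin (m + 1)) (σ : Fin m → P3 F) : Prop :=
  ∀ S, pointRank σ S = f.rank (S.map P.succAboveEmb)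

variable {f : PlanarSpace (m + 1)} {P : Fin (m + 1)} {σ : Fin m → P3 F} {d : ℕ}

-- Preserving ranks forces injectivity, so σ realizes some planar space, and that one has the ranks
-- of the deletion. Quantifying over all such g, of which there is at most one by `rank_injective`,
-- avoids constructing the deletion.
open Classical in
theorem realizesDeletion_iff : f.RealizesDeletion P σ ↔
    ∃ g ∈ Finset.univ.filter (f.IsDeletion P), g.IsStrongRealization σ := by
  simp only [Finset.mem_filter, Finset.mem_univ, true_and, isStrongRealization_iff]
  constructor
  · intro h
    have hσ : Function.Injective σ := by
      intro a b hab
      by_contra hne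
      refine pointRank_pair_iff.1 ?_ hab
      have h1 := two_le_rank (f := f) (S := ({a, b} : Finset (Fin m)).map P.succAboveEmb)
        (by rw [Finset.card_map, Finset.card_pair hne])
      have h2 := pointRank_le_card (σ := σ) (S := {a, b})
      rw [Finset.card_pair hne] at h2
      rw [← h] at h1
      omega
    obtain ⟨g, hg⟩ := exists_isStrongRealization hσ
    rw [isStrongRealization_iff] at hg
    exact ⟨g, fun S => (hg S).symm.trans (h S), hg⟩
  · rintro ⟨g, hg, h⟩ S
    exact (h S).trans (hg S)

theorem constraintSpan_le {S : Finset (Fin m)} (hS : f.Spans P (S.map P.succAboveEmb)) :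
    f.constraintSpan P σ ≤ pointSpan σ S :=
  iInf_le (fun S : {S : Finset (Fin m) // f.Spans P (S.map P.succAboveEmb)} => pointSpan σ S.1)
    ⟨S, hS⟩

/-- Every constraining span contains that of A or that of B, so the intersection is that of these
two. The dimension formula applies, the sum of the two spans being the span of the union. Without
constraints the intersection is the whole space, of dimension 4. -/
theorem RealizesDeletion.finrank_constraintSpan (hσ : f.RealizesDeletion P σ)
    (h : f.Located P d) : Module.finrank F (f.constraintSpan P σ) = d := by
  rcases h with ⟨rfl, h⟩ | ⟨A, B, hA, hB, h, rfl⟩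
  · have : IsEmpty {S : Finset (Fin m) // f.Spans P (S.map P.succAboveEmb)} := ⟨fun S => h _ S.2⟩
    rw [constraintSpan, iInf_of_empty, finrank_top, Module.finrank_fin_fun]
  · obtain ⟨A, rfl⟩ := exists_map_succAbove hA.1
    obtain ⟨B, rfl⟩ := exists_map_succAbove hB.1
    have hle : ∀ S T : Finset (Fin m), f.rank (S.map P.succAboveEmb ∪ T.map P.succAboveEmb) =
        f.rank (S.map P.succAboveEmb) → pointSpan σ T ≤ pointSpan σ S := by
      intro S T h
      rw [← Finset.map_union, ← hσ, ← hσ] at h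
      rw [pointSpan_eq_of_pointRank_le Finset.subset_union_left h.le]
      exact pointSpan_mono Finset.subset_union_right
    have hW : f.constraintSpan P σ = pointSpan σ A ⊓ pointSpan σ B := by
      refine le_antisymm (le_inf (constraintSpan_le hA) (constraintSpan_le hB))
        (le_iInf fun S => ?_)
      rcases h _ S.2 with h | h
      · exact inf_le_left.trans (hle _ _ h)
      · exact inf_le_right.trans (hle _ _ h)
    have := Submodule.finrank_sup_add_finrank_inf_eq (pointSpan σ A) (pointSpan σ B)
    rw [← pointSpan_union] at this
    rw [hW, ← Finset.map_union, ← hσ, ← hσ, ← hσ]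
    simp only [pointRank]
    omega

/-- Lying in a span is an equality of ranks. So the same points occupy the intersection in every
realization of the deletion, and their number can be taken out of the sum over σ. -/
theorem RealizesDeletion.rep_mem_constraintSpan_iff (hσ : f.RealizesDeletion P σ) {i : Fin m} :
    (σ i).rep ∈ f.constraintSpan P σ ↔ f.Coincident P (P.succAbove i) := by
  rw [constraintSpan, Submodule.mem_iInf]
  constructor
  · refine fun h => ⟨Fin.succAbove_ne _ _, fun S hS => ?_⟩
    obtain ⟨S, rfl⟩ := exists_map_succAbove hS.1
    have := rep_mem_pointSpan_iff.1 (h ⟨S, hS⟩)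
    rw [hσ, hσ, Finset.map_insert] at this
    exact this
  · rintro ⟨-, h⟩ ⟨S, hS⟩
    rw [rep_mem_pointSpan_iff, hσ, hσ, Finset.map_insert]
    exact h _ hS

theorem RealizesDeletion.injective (hσ : f.RealizesDeletion P σ) : Function.Injective σ := by
  classical
  obtain ⟨g, -, hg⟩ := realizesDeletion_iff.1 hσ
  exact hg.injective

open Classical in
theorem exists_degenerates_iff {σ : Fin (m + 1) → P3 F} :
    (∃ g ∈ Finset.univ.filter (f.Degenerates P), g.IsStrongRealization σ) ↔
      f.RealizesDeletion P (P.removeNth σ) ∧ (σ P).rep ∈ f.constraintSpan P (P.removeNth σ) ∧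
        σ P ∉ Set.range (P.removeNth σ) := by
  simp only [Finset.mem_filter, Finset.mem_univ, true_and]
  constructor
  · rintro ⟨g, ⟨h1, h2, h3⟩, hg⟩
    have hr := isStrongRealization_iff.1 hg
    refine ⟨fun S => ?_, ?_, ?_⟩
    · rw [← pointRank_map, hr, h1 _ notMem_map_succAbove]
    · rw [constraintSpan, Submodule.mem_iInf]
      rintro ⟨S, hS⟩
      rw [← pointSpan_map, rep_mem_pointSpan_iff, hr, hr, h2 _ hS]
    · rintro ⟨i, hi⟩
      exact Fin.succAbove_ne P i (hg.injective hi)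
  · rintro ⟨h1, h2, h3⟩
    have hinj : Function.Injective σ := by
      have hi := h1.injective
      rw [← Fin.insertNth_self_removeNth P σ]
      intro a b hab
      induction a using Fin.succAboveCases P with
      | x =>
        induction b using Fin.succAboveCases P with
        | x => rfl
        | p b => simp only [Fin.insertNth_apply_same, Fin.insertNth_apply_succAbove] at hab
                 exact absurd ⟨b, hab.symm⟩ h3
      | p a =>
        induction b using Fin.succAboveCases P with
        | x => simp only [Fin.insertNth_apply_same, Fin.insertNth_apply_succAbove] at hab
               exact absurd ⟨a, hab⟩ h3
        | p b => simp only [Fin.insertNth_apply_succAbove] at hab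
                 rw [hi hab]
    obtain ⟨g, hg⟩ := exists_isStrongRealization hinj
    have hr := isStrongRealization_iff.1 hg
    have hd1 : ∀ S, P ∉ S → g.rank S = f.rank S := by
      intro S hS
      obtain ⟨S, rfl⟩ := exists_map_succAbove hS
      rw [← hr, pointRank_map, h1]
    have hd2 : ∀ S, f.Spans P S → g.rank (insert P S) = g.rank S := by
      intro S hS
      obtain ⟨S, rfl⟩ := exists_map_succAbove hS.1
      rw [constraintSpan, Submodule.mem_iInf] at h2
      rw [← hr, ← hr, ← rep_mem_pointSpan_iff, pointSpan_map]
      exact h2 ⟨S, hS⟩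
    refine ⟨g, ⟨hd1, hd2, fun S => ?_⟩, hg⟩
    -- The bound by the ranks of f is automatic. Adding P to T raises the rank by at most one, and
    -- if it does not do so in f, then either f has rank 4 on T or P is constrained to the span of
    -- T.
    by_cases hP : P ∈ S
    · obtain ⟨T, hT, rfl⟩ : ∃ T, P ∉ T ∧ insert P T = S :=
        ⟨S.erase P, Finset.notMem_erase _ _, Finset.insert_erase hP⟩
      by_cases h4 : f.rank T = 4
      · exact rank_le_four.trans (h4 ▸ rank_mono (Finset.subset_insert _ _))
      by_cases h5 : f.rank (insert P T) = f.rank T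
      · rw [hd2 T ⟨hT, h5, h4⟩, hd1 T hT, h5]
      · have h6 := pointRank_insert_le (σ := σ) (S := T) P
        have h7 := rank_mono (f := f) (Finset.subset_insert P T)
        rw [hr, hr, hd1 T hT] at h6
        omega
    · exact (hd1 S hP).le

open Classical in
theorem RealizesDeletion.card_coincident (hσ : f.RealizesDeletion P σ) [Fintype (P3 F)] :
    (Finset.univ.filter fun x : P3 F => x.rep ∈ f.constraintSpan P σ ∧ x ∈ Set.range σ).card =
      (Finset.univ.filter (f.Coincident P)).card := by
  have h1 : (Finset.univ.filter fun x : P3 F => x.rep ∈ f.constraintSpan P σ ∧ x ∈ Set.range σ) =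
      (Finset.univ.filter fun i => (σ i).rep ∈ f.constraintSpan P σ).image σ := by
    ext x
    simp only [Finset.mem_filter, Finset.mem_univ, true_and, Finset.mem_image]
    constructor
    · rintro ⟨h, i, rfl⟩
      exact ⟨i, h, rfl⟩
    · rintro ⟨i, h, rfl⟩
      exact ⟨h, i, rfl⟩
  have h2 : Finset.univ.filter (f.Coincident P) =
      (Finset.univ.filter fun i => (σ i).rep ∈ f.constraintSpan P σ).map P.succAboveEmb := by
    ext x
    simp only [Finset.mem_filter, Finset.mem_univ, true_and, Finset.mem_map,
      hσ.rep_mem_constraintSpan_iff, Fin.coe_succAboveEmb]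
    constructor
    · intro h
      obtain ⟨i, rfl⟩ := Fin.exists_succAbove_eq h.1
      exact ⟨i, h, rfl⟩
    · rintro ⟨i, h, rfl⟩
      exact h
  rw [h1, h2, Finset.card_map, Finset.card_image_of_injective _ hσ.injective]

open Classical in
/-- Counting the positions of a located point over all realizations of the deletion. -/
theorem Located.count [Fintype F] (h : f.Located P d) :
    ∑ g ∈ Finset.univ.filter (f.Degenerates P), g.realizationCount F +
      (Finset.univ.filter (f.Coincident P)).card *
        ∑ g ∈ Finset.univ.filter (f.IsDeletion P), g.realizationCount F =
    (∑ i ∈ Finset.range d, Fintype.card F ^ i) *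
      ∑ g ∈ Finset.univ.filter (f.IsDeletion P), g.realizationCount F := by
  have : Fintype (P3 F) := Fintype.ofFinite _
  have hcard : ∀ {α : Type u} [Fintype α] (p : α → Prop),
      Nat.card {x // p x} = ∑ x, if p x then 1 else 0 := fun p => by
    rw [Nat.card_eq_fintype_card, Fintype.card_subtype, Finset.card_filter]
  simp only [sum_realizationCount, ← realizesDeletion_iff, exists_degenerates_iff]
  -- A family on m + 1 points is a position of P together with a family σ of the others, so it
  -- suffices to compare the contributions of each σ.
  rw [hcard, hcard, ← (Fin.insertNthEquiv (fun _ => P3 F) P).sum_comp,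
    Fintype.sum_prod_type_right, Finset.mul_sum, Finset.mul_sum,
    ← Finset.sum_add_distrib]
  refine Finset.sum_congr rfl fun σ _ => ?_
  have hrem : ∀ x, P.removeNth (Fin.insertNthEquiv (fun _ => P3 F) P (x, σ)) = σ := fun x =>
    Fin.removeNth_insertNth (α := fun _ => P3 F) P x σ
  simp only [hrem, Fin.insertNthEquiv_apply, Fin.insertNth_apply_same]
  by_cases hσ : f.RealizesDeletion P σ
  · simp only [hσ, true_and, if_true, mul_one]
    -- The points of the intersection are split into those in the range of σ and those free for P.
    rw [← hσ.card_coincident, ← hσ.finrank_constraintSpan h, ← card_points_eq,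
      Nat.card_eq_fintype_card, Fintype.card_subtype, ← Finset.card_filter, add_comm,
      ← Finset.filter_filter, ← Finset.filter_filter, Finset.card_filter_add_card_filter_not]
  · simp [hσ]

end PlanarSpace

/-! ### Closure rules for primitive recursive functions and predicates. -/

section PrimrecRules

attribute [fun_prop] Primrec PrimrecPred

variable {α β γ σ : Type*} [Primcodable α] [Primcodable β] [Primcodable γ] [Primcodable σ]

attribute [fun_prop] Primrec.id Primrec.const Primrec.comp

@[fun_prop]
theorem Primrec.fun_fst {f : α → β × γ} (hf : Primrec f) : Primrec fun a => (f a).1 :=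
  Primrec.fst.comp hf

@[fun_prop]
theorem Primrec.fun_snd {f : α → β × γ} (hf : Primrec f) : Primrec fun a => (f a).2 :=
  Primrec.snd.comp hf

attribute [fun_prop] Primrec.pair

@[fun_prop]
theorem Primrec.fun_cons {f : α → β} {g : α → List β} (hf : Primrec f) (hg : Primrec g) :
    Primrec fun a => f a :: g a := Primrec.list_cons.comp hf hg

@[fun_prop]
theorem Primrec.fun_eq {f g : α → β} (hf : Primrec f) (hg : Primrec g) :
    PrimrecPred fun a => f a = g a := Primrec.eq.comp hf hg

@[fun_prop]
theorem Primrec.fun_mem {f : α → β} {g : α → List β} (hf : Primrec f) (hg : Primrec g) :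
    PrimrecPred fun a => f a ∈ g a :=
  ((PrimrecRel.exists_mem_list (R := fun x y : β => x = y) Primrec.eq).comp hg hf).of_eq
    fun a => by simp

attribute [fun_prop] PrimrecPred.not PrimrecPred.and PrimrecPred.or

@[fun_prop]
theorem PrimrecPred.imp {p q : α → Prop} (hp : PrimrecPred p) (hq : PrimrecPred q) :
    PrimrecPred fun a => p a → q a :=
  (hp.not.or hq).of_eq fun a => by tauto

theorem PrimrecPred.ball {l : α → List β} {p : α → β → Prop} (hl : Primrec l)
    (hp : PrimrecPred fun x : α × β => p x.1 x.2) :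
    PrimrecPred fun a => ∀ x ∈ l a, p a x :=
  (PrimrecRel.forall_mem_list (R := fun x y => p y x)
    (hp.comp (Primrec.pair .snd .fst))).comp hl .id

theorem PrimrecPred.bex {l : α → List β} {p : α → β → Prop} (hl : Primrec l)
    (hp : PrimrecPred fun x : α × β => p x.1 x.2) :
    PrimrecPred fun a => ∃ x ∈ l a, p a x :=
  (PrimrecRel.exists_mem_list (R := fun x y => p y x)
    (hp.comp (Primrec.pair .snd .fst))).comp hl .id

@[fun_prop]
theorem Primrec.fun_append {f g : α → List β} (hf : Primrec f) (hg : Primrec g) :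
    Primrec fun a => f a ++ g a := Primrec.list_append.comp hf hg

@[fun_prop]
theorem Primrec.fun_length {f : α → List β} (hf : Primrec f) :
    Primrec fun a => (f a).length := Primrec.list_length.comp hf

@[fun_prop]
theorem Primrec.fun_range {f : α → ℕ} (hf : Primrec f) :
    Primrec fun a => List.range (f a) := Primrec.list_range.comp hf

@[fun_prop]
theorem Primrec.fun_headI [Inhabited β] {f : α → List β} (hf : Primrec f) :
    Primrec fun a => (f a).headI := Primrec.list_headI.comp hf

@[fun_prop]
theorem Primrec.fun_getD {f : α → List β} {g : α → ℕ} (d : β) (hf : Primrec f) (hg : Primrec g) :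
    Primrec fun a => (f a).getD (g a) d := (Primrec.list_getD d).comp hf hg

@[fun_prop]
theorem Primrec.fun_add {f g : α → ℕ} (hf : Primrec f) (hg : Primrec g) :
    Primrec fun a => f a + g a := Primrec.nat_add.comp hf hg

@[fun_prop]
theorem Primrec.fun_sub {f g : α → ℕ} (hf : Primrec f) (hg : Primrec g) :
    Primrec fun a => f a - g a := Primrec.nat_sub.comp hf hg

@[fun_prop]
theorem Primrec.fun_mul {f g : α → ℕ} (hf : Primrec f) (hg : Primrec g) :
    Primrec fun a => f a * g a := Primrec.nat_mul.comp hf hg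

@[fun_prop]
theorem Primrec.fun_mod {f g : α → ℕ} (hf : Primrec f) (hg : Primrec g) :
    Primrec fun a => f a % g a := Primrec.nat_mod.comp hf hg

@[fun_prop]
theorem Primrec.fun_le {f g : α → ℕ} (hf : Primrec f) (hg : Primrec g) :
    PrimrecPred fun a => f a ≤ g a := Primrec.nat_le.comp hf hg

@[fun_prop]
theorem Primrec.fun_lt {f g : α → ℕ} (hf : Primrec f) (hg : Primrec g) :
    PrimrecPred fun a => f a < g a := Primrec.nat_lt.comp hf hg

@[fun_prop]
theorem Primrec.fun_notMem {f : α → β} {g : α → List β} (hf : Primrec f) (hg : Primrec g) :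
    PrimrecPred fun a => f a ∉ g a := (Primrec.fun_mem hf hg).not

@[fun_prop]
theorem Primrec.fun_ite {p : α → Prop} {_ : ∀ a, Decidable (p a)} {f g : α → β}
    (hp : PrimrecPred p) (hf : Primrec f) (hg : Primrec g) :
    Primrec fun a => if p a then f a else g a := Primrec.ite hp hf hg

theorem Primrec.fun_map {l : α → List β} {f : α → β → γ} (hl : Primrec l)
    (hf : Primrec fun x : α × β => f x.1 x.2) : Primrec fun a => (l a).map (f a) :=
  Primrec.list_map hl hf

theorem Primrec.fun_flatMap {l : α → List β} {f : α → β → List γ} (hl : Primrec l)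
    (hf : Primrec fun x : α × β => f x.1 x.2) : Primrec fun a => (l a).flatMap (f a) :=
  Primrec.list_flatMap hl hf

theorem Primrec.fun_filter {l : α → List β} {p : α → β → Prop} {_ : ∀ a b, Decidable (p a b)}
    (hl : Primrec l) (hp : PrimrecPred fun x : α × β => p x.1 x.2) :
    Primrec fun a => (l a).filter fun x => p a x :=
  (Primrec.fun_flatMap hl (f := fun a x => if p a x then [x] else []) (by fun_prop)).of_eq
    fun a => by
      induction l a with
      | nil => rfl
      | cons x l ih => rw [List.flatMap_cons, List.filter_cons, ih]; split_ifs <;> simp_all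

@[fun_prop]
theorem Primrec.fun_sublists {l : α → List β} (hl : Primrec l) :
    Primrec fun a => (l a).sublists :=
  (Primrec.list_foldr
    (h := fun _ (x : β × List (List β)) => x.2.flatMap fun y => [y, x.1 :: y]) hl
    (Primrec.const [[]])
    (show Primrec fun x : α × β × List (List β) => x.2.2.flatMap fun y => [y, x.2.1 :: y] from
      Primrec.fun_flatMap (by fun_prop) (by fun_prop))).of_eq
    fun a => by
      induction l a with
      | nil => rfl
      | cons x l ih => rw [List.sublists_cons, List.foldr_cons, ih]; rfl

@[fun_prop]
theorem Primrec.fun_natSub {f g : α → ℕ} (hf : Primrec f) (hg : Primrec g) :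
    Primrec fun a => (f a : ℤ) - (g a : ℤ) := by
  have h : Primrec fun a => Encodable.encode ((f a : ℤ) - (g a : ℤ)) := by
    -- Integers are encoded by n ↦ 2n for n ≥ 0 and by -(k + 1) ↦ 2k + 1.
    have h1 : Primrec fun a => if g a ≤ f a then 2 * (f a - g a) else 2 * (g a - f a - 1) + 1 := by
      fun_prop
    refine h1.of_eq fun a => ?_
    split_ifs with h
    · rw [← Int.ofNat_sub h]
      rfl
    · obtain ⟨k, hk⟩ := Nat.exists_eq_add_of_lt (not_le.1 h)
      have h2 : (f a : ℤ) - (g a : ℤ) = Int.negSucc k := by rw [hk, Int.negSucc_eq]; push_cast; ring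
      have h3 : g a - f a - 1 = k := by omega
      rw [h2, h3]
      rfl
  exact Primrec.encode_iff.1 h

end PrimrecRules

/-! ### The reduction algorithm on codes. -/

/-- Codes of planar spaces. -/
abbrev SpaceCode : Type := ℕ × List (List ℕ) × List (List ℕ)

/-- A term `(s, e, c)` stands for `(-1) ^ s * q ^ e` times the number of strong realizations of the
planar space with code `c`. -/
abbrev CodeTerm : Type := ℕ × ℕ × SpaceCode

namespace SpaceCode

/-- The sublists of `0, …, m - 1`. -/
def subsets (m : ℕ) : List (List ℕ) := (List.range m).sublists

/-- The lists of length `k` with entries less than `m`. -/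
def tuples (m k : ℕ) : List (List ℕ) :=
  Nat.rec [[]] (fun _ ls => ls.flatMap fun l => (List.range m).map fun x => x :: l) k

open Classical in
/-- The rank of a list of points. -/
noncomputable def rank (c : SpaceCode) (l : List ℕ) : ℕ :=
  if l = [] then 0 else if ∀ x ∈ l, ∀ y ∈ l, x = y then 1
    else if ∃ L ∈ c.2.1, ∀ x ∈ l, x ∈ L then 2
      else if ∃ H ∈ c.2.2, ∀ x ∈ l, x ∈ H then 3 else 4

/-- The conditions that define planar spaces. -/
def IsPlanar (c : SpaceCode) : Prop :=
  (∀ L ∈ c.2.1, 2 ≤ L.length) ∧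
    (∀ x ∈ List.range c.1, ∀ y ∈ List.range c.1, x ≠ y →
      ∃ L ∈ c.2.1, (x ∈ L ∧ y ∈ L) ∧ ∀ L' ∈ c.2.1, x ∈ L' ∧ y ∈ L' → L' = L) ∧
    (∀ x ∈ List.range c.1, ∀ y ∈ List.range c.1, ∀ z ∈ List.range c.1, x ≠ y → x ≠ z → y ≠ z →
      (¬ ∃ L ∈ c.2.1, x ∈ L ∧ y ∈ L ∧ z ∈ L) →
      ∃ H ∈ c.2.2, (x ∈ H ∧ y ∈ H ∧ z ∈ H) ∧
        ∀ H' ∈ c.2.2, x ∈ H' ∧ y ∈ H' ∧ z ∈ H' → H' = H) ∧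
    ∀ H ∈ c.2.2, 3 ≤ H.length ∧ ∀ L ∈ c.2.1, ¬ ∀ x ∈ H, x ∈ L

/-- The codes of families of subsets of `0, …, m - 1`. -/
def families (m : ℕ) : List (List (List ℕ)) := (subsets m).sublists

open Classical in
/-- The codes of the planar spaces on `m` points. -/
noncomputable def all (m : ℕ) : List SpaceCode :=
  ((families m).flatMap fun Ls => (families m).map fun Hs => (m, Ls, Hs)).filter
    fun c => IsPlanar c

/-- The counterpart of `PlanarSpace.ClosureMono`. -/
def ClosureMono (c : SpaceCode) : Prop :=
  ∀ S ∈ subsets c.1, ∀ T ∈ subsets c.1, (∀ x ∈ S, x ∈ T) → ∀ x ∈ List.range c.1,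
    rank c (x :: S) = rank c S → rank c (x :: T) = rank c T

/-- The counterpart of `PlanarSpace.Spans`. -/
def Spans (c : SpaceCode) (P : ℕ) (S : List ℕ) : Prop :=
  P ∉ S ∧ rank c (P :: S) = rank c S ∧ rank c S ≠ 4

/-- The counterpart of `PlanarSpace.Located`. -/
def Located (c : SpaceCode) (P d : ℕ) : Prop :=
  (d = 4 ∧ ∀ S ∈ subsets c.1, ¬ Spans c P S) ∨
    ∃ A ∈ subsets c.1, ∃ B ∈ subsets c.1, Spans c P A ∧ Spans c P B ∧
      (∀ S ∈ subsets c.1, Spans c P S →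
        rank c (S ++ A) = rank c S ∨ rank c (S ++ B) = rank c S) ∧
      d = rank c A + rank c B - rank c (A ++ B)

/-- The counterpart of `PlanarSpace.Degenerates`. -/
def Degenerates (c : SpaceCode) (P : ℕ) (g : SpaceCode) : Prop :=
  (∀ S ∈ subsets c.1, P ∉ S → rank g S = rank c S) ∧
    (∀ S ∈ subsets c.1, Spans c P S → rank g (P :: S) = rank g S) ∧
      ∀ S ∈ subsets c.1, rank g S ≤ rank c S

/-- The counterpart of `PlanarSpace.Coincident`. -/
def Coincident (c : SpaceCode) (P Q : ℕ) : Prop :=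
  Q ≠ P ∧ ∀ S ∈ subsets c.1, Spans c P S → rank c (Q :: S) = rank c S

/-- The counterpart of `PlanarSpace.IsDeletion`. -/
def IsDeletion (c : SpaceCode) (P : ℕ) (g : SpaceCode) : Prop :=
  ∀ S ∈ subsets (c.1 - 1), rank g S = rank c (S.map fun x => if x < P then x else x + 1)

/-- The counterpart of `PlanarSpace.Isomorphic`. -/
def Isomorphic (c d : SpaceCode) : Prop :=
  c.1 = d.1 ∧ ∃ π ∈ tuples c.1 c.1, ∀ S ∈ subsets c.1,
    rank d (S.map fun x => π.getD x 0) = rank c S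

open Classical in
/-- The pairs `(P, d)` such that `P` is located with dimension `d`. -/
noncomputable def candidates (c : SpaceCode) : List (ℕ × ℕ) :=
  ((List.range c.1).flatMap fun P => (List.range 9).map fun d => (P, d)).filter
    fun y => Located c y.1 y.2

open Classical in
/-- Replace a planar space with located point `y.1` by spaces with fewer points or smaller ranks. -/
noncomputable def reduce (t : CodeTerm) (y : ℕ × ℕ) : List CodeTerm :=
  ((all t.2.2.1).filter fun g => Degenerates t.2.2 y.1 g ∧ g ≠ t.2.2).map
      (fun g => (t.1 + 1, t.2.1, g)) ++
    ((all (t.2.2.1 - 1)).filter fun g => IsDeletion t.2.2 y.1 g).flatMap fun g =>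
      (List.range y.2).map (fun i => (t.1, t.2.1 + i, g)) ++
        ((List.range t.2.2.1).filter fun Q => Coincident t.2.2 y.1 Q).map
          fun _ => (t.1 + 1, t.2.1, g)

open Classical in
/-- One step of the reduction of a term. -/
noncomputable def step (t : CodeTerm) : List CodeTerm :=
  if ClosureMono t.2.2 then
    if candidates t.2.2 = [] then [t] else reduce t (candidates t.2.2).headI
  else []

/-- A number of steps after which the terms on `m` points are reduced completely. -/
def stepBound (m : ℕ) : ℕ := m + 4 * (subsets m).length

/-- The complete reduction of terms on at most `m` points. -/
noncomputable def run (m : ℕ) (ts : List CodeTerm) : List CodeTerm :=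
  (fun ts => ts.flatMap step)^[stepBound m] ts

/-- The coefficients of `∑ (-1) ^ s * X ^ e` over terms `(s, e, c)`. -/
def coeffs (ts : List CodeTerm) : List ℤ :=
  (List.range ((ts.foldr (fun t k => t.2.1 + k) 0) + 1)).map fun j =>
    (((ts.filter fun t => t.2.1 = j ∧ t.1 % 2 = 0).length : ℕ) : ℤ) -
      ((ts.filter fun t => t.2.1 = j ∧ t.1 % 2 ≠ 0).length : ℕ)

/-- The coefficients of the terms without points. -/
noncomputable def constCoeffs (ts : List CodeTerm) : List ℤ :=
  coeffs (ts.filter fun t => t.2.2.1 = 0)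

open Classical in
/-- The coefficients of the terms isomorphic to `h`. -/
noncomputable def isoCoeffs (ts : List CodeTerm) (h : SpaceCode) : List ℤ :=
  coeffs (ts.filter fun t => Isomorphic t.2.2 h)

open Classical in
/-- The terms for the planar spaces on `n` points without full lines. -/
noncomputable def capTerms (n : ℕ) : List CodeTerm :=
  ((all n).filter fun c => ∀ L ∈ c.2.1, L.length ≤ 2).map fun c => (0, 0, c)

/-! ### The algorithm is primitive recursive. -/

section Primrec

variable {α : Type*} [Primcodable α]

@[fun_prop]
theorem primrec_subsets {f : α → ℕ} (hf : Primrec f) : Primrec fun a => subsets (f a) := by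
  unfold subsets; fun_prop

@[fun_prop]
theorem primrec_families {f : α → ℕ} (hf : Primrec f) : Primrec fun a => families (f a) := by
  unfold families; fun_prop

@[fun_prop]
theorem primrec_tuples {f g : α → ℕ} (hf : Primrec f) (hg : Primrec g) :
    Primrec fun a => tuples (f a) (g a) := by
  have h : Primrec₂ tuples :=
    Primrec.nat_rec (f := fun _ => [[]])
      (g := fun m p => p.2.flatMap fun l => (List.range m).map fun x => x :: l) (.const _)
      (Primrec.fun_flatMap (f := fun (y : ℕ × ℕ × List (List ℕ)) l =>
        (List.range y.1).map fun x => x :: l) (by fun_prop)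
        (Primrec.fun_map (by fun_prop) (by fun_prop)))
  exact h.comp hf hg

@[fun_prop]
theorem primrec_rank {f : α → SpaceCode} {g : α → List ℕ} (hf : Primrec f) (hg : Primrec g) :
    Primrec fun a => rank (f a) (g a) := by
  unfold rank
  refine Primrec.fun_ite (by fun_prop) (by fun_prop) (Primrec.fun_ite ?_ (by fun_prop)
    (Primrec.fun_ite ?_ (by fun_prop) (Primrec.fun_ite ?_ (by fun_prop) (by fun_prop))))
  · exact .ball (by fun_prop) (.ball (by fun_prop) (by fun_prop))
  · exact .bex (by fun_prop) (.ball (by fun_prop) (by fun_prop))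
  · exact .bex (by fun_prop) (.ball (by fun_prop) (by fun_prop))

theorem primrec_isPlanar : PrimrecPred IsPlanar := by
  refine .and (.ball (by fun_prop) (by fun_prop)) (.and ?_ (.and ?_ ?_))
  · exact .ball (by fun_prop) (.ball (by fun_prop) (.imp (by fun_prop)
      (.bex (by fun_prop) (.and (by fun_prop) (.ball (by fun_prop) (by fun_prop))))))
  · exact .ball (by fun_prop) (.ball (by fun_prop) (.ball (by fun_prop) (.imp (by fun_prop)
      (.imp (by fun_prop) (.imp (by fun_prop) (.imp (.not (.bex (by fun_prop) (by fun_prop)))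
      (.bex (by fun_prop) (.and (by fun_prop) (.ball (by fun_prop) (by fun_prop))))))))))
  · exact .ball (by fun_prop) (.and (by fun_prop) (.ball (by fun_prop)
      (.not (.ball (by fun_prop) (by fun_prop)))))

@[fun_prop]
theorem primrec_all {f : α → ℕ} (hf : Primrec f) : Primrec fun a => all (f a) := by
  unfold all
  exact Primrec.fun_filter (Primrec.fun_flatMap (by fun_prop)
    (Primrec.fun_map (by fun_prop) (by fun_prop))) (primrec_isPlanar.comp .snd)

theorem primrec_closureMono : PrimrecPred ClosureMono :=
  .ball (by fun_prop) (.ball (by fun_prop) (.imp (.ball (by fun_prop) (by fun_prop))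
    (.ball (by fun_prop) (by fun_prop))))

@[fun_prop]
theorem primrec_spans {f : α → SpaceCode} {g : α → ℕ} {h : α → List ℕ} (hf : Primrec f)
    (hg : Primrec g) (hh : Primrec h) : PrimrecPred fun a => Spans (f a) (g a) (h a) := by
  unfold Spans
  fun_prop

@[fun_prop]
theorem primrec_located {f : α → SpaceCode} {g h : α → ℕ} (hf : Primrec f)
    (hg : Primrec g) (hh : Primrec h) : PrimrecPred fun a => Located (f a) (g a) (h a) :=
  .or (.and (by fun_prop) (.ball (by fun_prop) (by fun_prop)))
    (.bex (by fun_prop) (.bex (by fun_prop) (.and (by fun_prop) (.and (by fun_prop)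
      (.and (.ball (by fun_prop) (by fun_prop)) (by fun_prop))))))

@[fun_prop]
theorem primrec_degenerates {f h : α → SpaceCode} {g : α → ℕ} (hf : Primrec f)
    (hg : Primrec g) (hh : Primrec h) : PrimrecPred fun a => Degenerates (f a) (g a) (h a) :=
  .and (.ball (by fun_prop) (by fun_prop)) (.and (.ball (by fun_prop) (by fun_prop))
    (.ball (by fun_prop) (by fun_prop)))

@[fun_prop]
theorem primrec_coincident {f : α → SpaceCode} {g h : α → ℕ} (hf : Primrec f)
    (hg : Primrec g) (hh : Primrec h) : PrimrecPred fun a => Coincident (f a) (g a) (h a) :=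
  .and (by fun_prop) (.ball (by fun_prop) (by fun_prop))

@[fun_prop]
theorem primrec_isDeletion {f h : α → SpaceCode} {g : α → ℕ} (hf : Primrec f)
    (hg : Primrec g) (hh : Primrec h) : PrimrecPred fun a => IsDeletion (f a) (g a) (h a) :=
  .ball (by fun_prop) (Primrec.fun_eq (by fun_prop) (primrec_rank (by fun_prop)
    (Primrec.fun_map (by fun_prop) (by fun_prop))))

@[fun_prop]
theorem primrec_isomorphic {f g : α → SpaceCode} (hf : Primrec f) (hg : Primrec g) :
    PrimrecPred fun a => Isomorphic (f a) (g a) :=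
  .and (by fun_prop) (.bex (by fun_prop) (.ball (by fun_prop) (Primrec.fun_eq
    (primrec_rank (by fun_prop) (Primrec.fun_map (by fun_prop) (by fun_prop))) (by fun_prop))))

@[fun_prop]
theorem primrec_candidates {f : α → SpaceCode} (hf : Primrec f) :
    Primrec fun a => candidates (f a) := by
  unfold candidates
  exact Primrec.fun_filter (Primrec.fun_flatMap (by fun_prop)
    (Primrec.fun_map (by fun_prop) (by fun_prop))) (by fun_prop)

@[fun_prop]
theorem primrec_reduce {f : α → CodeTerm} {g : α → ℕ × ℕ} (hf : Primrec f) (hg : Primrec g) :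
    Primrec fun a => reduce (f a) (g a) := by
  unfold reduce
  refine Primrec.fun_append (Primrec.fun_map (Primrec.fun_filter (by fun_prop) (by fun_prop))
    (by fun_prop)) (Primrec.fun_flatMap (Primrec.fun_filter (by fun_prop) (by fun_prop)) ?_)
  exact Primrec.fun_append (Primrec.fun_map (by fun_prop) (by fun_prop))
    (Primrec.fun_map (Primrec.fun_filter (by fun_prop) (by fun_prop)) (by fun_prop))

theorem primrec_step : Primrec step := by
  unfold step
  exact Primrec.fun_ite (primrec_closureMono.comp (by fun_prop)) (by fun_prop) (by fun_prop)

@[fun_prop]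
theorem primrec_run {f : α → ℕ} {g : α → List CodeTerm} (hf : Primrec f) (hg : Primrec g) :
    Primrec fun a => run (f a) (g a) := by
  unfold run stepBound
  exact Primrec.nat_iterate (f := fun a => f a + 4 * (subsets (f a)).length)
    (h := fun _ (ts : List CodeTerm) => ts.flatMap step) (by fun_prop) hg
    (show Primrec fun x : α × List CodeTerm => x.2.flatMap step from
      Primrec.fun_flatMap (by fun_prop) (primrec_step.comp (by fun_prop)))

theorem primrec_coeffs : Primrec coeffs := by
  unfold coeffs
  refine Primrec.fun_map (Primrec.fun_range (Primrec.fun_add ?_ (by fun_prop))) ?_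
  · exact Primrec.list_foldr (h := fun _ (x : CodeTerm × ℕ) => x.1.2.1 + x.2) .id (.const 0)
      (show Primrec fun x : List CodeTerm × CodeTerm × ℕ => x.2.1.2.1 + x.2.2 by fun_prop)
  · refine Primrec.fun_natSub (Primrec.fun_length (Primrec.fun_filter ?_ ?_))
      (Primrec.fun_length (Primrec.fun_filter ?_ ?_)) <;> fun_prop

theorem primrec_constCoeffs : Primrec constCoeffs :=
  primrec_coeffs.comp (Primrec.fun_filter (by fun_prop) (by fun_prop))

theorem primrec_isoCoeffs : Primrec₂ isoCoeffs :=
  primrec_coeffs.comp (Primrec.fun_filter (by fun_prop) (by fun_prop))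

@[fun_prop]
theorem primrec_capTerms {f : α → ℕ} (hf : Primrec f) : Primrec fun a => capTerms (f a) := by
  unfold capTerms
  exact Primrec.fun_map (Primrec.fun_filter (by fun_prop) (.ball (by fun_prop) (by fun_prop)))
    (by fun_prop)

end Primrec

end SpaceCode

/-! ### Codes agree with planar spaces. -/

/-- A sublist of a list without repetitions is determined by its members. Hence each set of points,
and each family of such sets, has exactly one code. -/
theorem List.Sublist.eq_filter_mem {α : Type*} [DecidableEq α] {l' l : List α} (h : l'.Sublist l)
    (hl : l.Nodup) : l' = l.filter (· ∈ l') := by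
  induction h with
  | slnil => rfl
  | @cons l₁ l₂ a h ih =>
    rw [List.nodup_cons] at hl
    rw [List.filter_cons_of_neg (by simpa using fun h' => hl.1 (h.subset h'))]
    exact ih hl.2
  | @cons_cons l₁ l₂ a h ih =>
    rw [List.nodup_cons] at hl
    rw [List.filter_cons_of_pos (by simp)]
    congr 1
    refine (ih hl.2).trans (List.filter_congr fun x hx => ?_)
    have : x ≠ a := fun e => hl.1 (e ▸ hx)
    simp [this]

namespace SpaceCode

variable {m : ℕ}

/-- A set of points as increasing list of numbers. -/
def setCode (S : Finset (Fin m)) : List ℕ := ((List.finRange m).filter (· ∈ S)).map Fin.val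

theorem mem_setCode {S : Finset (Fin m)} {x : ℕ} : x ∈ setCode S ↔ ∃ i ∈ S, i.val = x := by
  simp [setCode]

theorem val_mem_setCode {S : Finset (Fin m)} {i : Fin m} : i.val ∈ setCode S ↔ i ∈ S := by
  rw [mem_setCode]
  exact ⟨fun ⟨j, hj, h⟩ => Fin.ext h ▸ hj, fun h => ⟨i, h, rfl⟩⟩

theorem setCode_injective : Function.Injective (setCode : Finset (Fin m) → List ℕ) := by
  intro S T h
  ext i
  rw [← val_mem_setCode, h, val_mem_setCode]

theorem length_setCode (S : Finset (Fin m)) : (setCode S).length = S.card := by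
  rw [setCode, List.length_map, ← List.toFinset_card_of_nodup ((List.nodup_finRange m).filter _)]
  congr 1
  ext i
  simp

theorem subsets_eq_map : subsets m = (List.finRange m).sublists.map (List.map Fin.val) := by
  rw [subsets, ← List.sublists_map, List.map_coe_finRange_eq_range]

theorem map_val_of_mem_sublists {l : List (Fin m)} (h : l ∈ (List.finRange m).sublists) :
    l.map Fin.val = setCode l.toFinset := by
  rw [List.mem_sublists] at h
  rw [setCode]
  conv_lhs => rw [h.eq_filter_mem (List.nodup_finRange m)]
  simp

theorem mem_subsets {l : List ℕ} : l ∈ subsets m ↔ ∃ S : Finset (Fin m), setCode S = l := by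
  rw [subsets_eq_map, List.mem_map]
  constructor
  · rintro ⟨l, hl, rfl⟩
    exact ⟨_, (map_val_of_mem_sublists hl).symm⟩
  · rintro ⟨S, rfl⟩
    exact ⟨_, List.mem_sublists.2 List.filter_sublist, rfl⟩

theorem nodup_subsets : (subsets m).Nodup := List.nodup_sublists.2 List.nodup_range

theorem length_subsets : (subsets m).length = 2 ^ m := by
  rw [subsets, List.length_sublists, List.length_range]

theorem forall_mem_subsets {p : List ℕ → Prop} :
    (∀ l ∈ subsets m, p l) ↔ ∀ S : Finset (Fin m), p (setCode S) := by
  simp [mem_subsets]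

theorem exists_mem_subsets {p : List ℕ → Prop} :
    (∃ l ∈ subsets m, p l) ↔ ∃ S : Finset (Fin m), p (setCode S) := by
  simp [mem_subsets]

theorem mem_familyCode {𝓢 : Finset (Finset (Fin m))} {l : List ℕ} :
    l ∈ familyCode 𝓢 ↔ ∃ S ∈ 𝓢, setCode S = l := by
  rw [familyCode, List.mem_map]
  constructor
  · rintro ⟨l, hl, rfl⟩
    rw [List.mem_filter] at hl
    exact ⟨_, by simpa using hl.2, (map_val_of_mem_sublists hl.1).symm⟩
  · rintro ⟨S, hS, rfl⟩
    refine ⟨_, List.mem_filter.2 ⟨List.mem_sublists.2 List.filter_sublist, ?_⟩, rfl⟩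
    have : ((List.finRange m).filter (· ∈ S)).toFinset = S := by ext; simp
    simpa [this] using hS

theorem familyCode_mem_families (𝓢 : Finset (Finset (Fin m))) : familyCode 𝓢 ∈ families m := by
  rw [families, List.mem_sublists, subsets_eq_map, familyCode]
  exact List.filter_sublist.map _

theorem mem_families {l : List (List ℕ)} :
    l ∈ families m ↔ ∃ 𝓢 : Finset (Finset (Fin m)), familyCode 𝓢 = l := by
  classical
  constructor
  · intro h
    rw [families, List.mem_sublists] at h
    refine ⟨Finset.univ.filter fun S => setCode S ∈ l, ?_⟩
    have h2 := familyCode_mem_families (Finset.univ.filter fun S : Finset (Fin m) => setCode S ∈ l)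
    rw [families, List.mem_sublists] at h2
    refine (h2.eq_filter_mem nodup_subsets).trans
      (Eq.trans ?_ (h.eq_filter_mem nodup_subsets).symm)
    refine List.filter_congr fun x hx => ?_
    obtain ⟨S, rfl⟩ := mem_subsets.1 hx
    rw [decide_eq_decide]
    simp only [mem_familyCode, setCode_injective.eq_iff, exists_eq_right, Finset.mem_filter,
      Finset.mem_univ, true_and]
  · rintro ⟨𝓢, rfl⟩
    exact familyCode_mem_families 𝓢

theorem familyCode_injective :
    Function.Injective (familyCode : Finset (Finset (Fin m)) → List (List ℕ)) := by
  intro 𝓢 𝓣 h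
  ext S
  have key : ∀ 𝓤 : Finset (Finset (Fin m)), setCode S ∈ familyCode 𝓤 ↔ S ∈ 𝓤 := fun 𝓤 => by
    simp [mem_familyCode, setCode_injective.eq_iff]
  rw [← key, h, key]

theorem code_injective : Function.Injective (PlanarSpace.code : PlanarSpace m → SpaceCode) := by
  intro f g h
  simp only [PlanarSpace.code, Prod.mk.injEq, true_and] at h
  exact PlanarSpace.ext (familyCode_injective h.1) (familyCode_injective h.2)

theorem forall_mem_familyCode {𝓢 : Finset (Finset (Fin m))} {p : List ℕ → Prop} :
    (∀ l ∈ familyCode 𝓢, p l) ↔ ∀ S ∈ 𝓢, p (setCode S) := by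
  simp [mem_familyCode]

theorem exists_mem_familyCode {𝓢 : Finset (Finset (Fin m))} {p : List ℕ → Prop} :
    (∃ l ∈ familyCode 𝓢, p l) ↔ ∃ S ∈ 𝓢, p (setCode S) := by
  simp [mem_familyCode]

theorem forall_mem_range {p : ℕ → Prop} : (∀ x ∈ List.range m, p x) ↔ ∀ i : Fin m, p i := by
  simp [Fin.forall_iff]

theorem forall_mem_setCode {S T : Finset (Fin m)} :
    (∀ x ∈ setCode S, x ∈ setCode T) ↔ S ⊆ T := by
  simp only [mem_setCode (S := S), forall_exists_index, and_imp, forall_apply_eq_imp_iff₂,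
    val_mem_setCode]
  rfl

theorem isPlanar_iff {𝓛 𝓗 : Finset (Finset (Fin m))} :
    IsPlanar (m, familyCode 𝓛, familyCode 𝓗) ↔
      ∃ f : PlanarSpace m, f.lines = 𝓛 ∧ f.planes = 𝓗 := by
  simp only [IsPlanar, forall_mem_familyCode, exists_mem_familyCode, forall_mem_range,
    forall_mem_setCode, val_mem_setCode, length_setCode, setCode_injective.eq_iff, ne_eq,
    Fin.val_inj]
  constructor
  · rintro ⟨h1, h2, h3, h4⟩
    refine ⟨⟨𝓛, 𝓗, h1, fun a b hab => ?_, fun a b c hab hac hbc hn => ?_, h4⟩, rfl, rfl⟩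
    · obtain ⟨L, hL, hab, h⟩ := h2 a b hab
      exact ⟨L, ⟨hL, hab⟩, fun L' hL' => h L' hL'.1 hL'.2⟩
    · obtain ⟨L, hL, hab, h⟩ := h3 a b c hab hac hbc hn
      exact ⟨L, ⟨hL, hab⟩, fun L' hL' => h L' hL'.1 hL'.2⟩
  · rintro ⟨f, rfl, rfl⟩
    refine ⟨f.two_le_card_line, fun a b hab => ?_, fun a b c hab hac hbc hn => ?_,
      f.plane_noncollinear⟩
    · obtain ⟨L, hL, h⟩ := f.existsUnique_line a b hab
      exact ⟨L, hL.1, hL.2, fun L' h1 h2 => h L' ⟨h1, h2⟩⟩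
    · obtain ⟨L, hL, h⟩ := f.existsUnique_plane a b c hab hac hbc hn
      exact ⟨L, hL.1, hL.2, fun L' h1 h2 => h L' ⟨h1, h2⟩⟩

theorem mem_all {c : SpaceCode} : c ∈ all m ↔ ∃ f : PlanarSpace m, f.code = c := by
  simp only [all, List.mem_filter, List.mem_flatMap, List.mem_map, decide_eq_true_eq, mem_families]
  constructor
  · rintro ⟨⟨_, ⟨𝓛, rfl⟩, _, ⟨𝓗, rfl⟩, rfl⟩, h⟩
    obtain ⟨f, rfl, rfl⟩ := isPlanar_iff.1 h
    exact ⟨f, rfl⟩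
  · rintro ⟨f, rfl⟩
    exact ⟨⟨_, ⟨f.lines, rfl⟩, _, ⟨f.planes, rfl⟩, rfl⟩, isPlanar_iff.2 ⟨f, rfl, rfl⟩⟩

/-- Sums over this list replace sums over planar spaces, so none may be listed twice. -/
theorem nodup_all : (all m).Nodup := by
  have h : (families m).Nodup := List.nodup_sublists.2 nodup_subsets
  refine List.Nodup.filter _ (List.nodup_flatMap.2 ⟨fun l _ => h.map fun a b hab => ?_, ?_⟩)
  · simpa using hab
  · refine List.Pairwise.imp (fun {a b} hab => ?_) h
    rw [Function.onFun, List.disjoint_left]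
    intro x hx hx'
    simp only [List.mem_map] at hx hx'
    obtain ⟨_, _, rfl⟩ := hx
    obtain ⟨_, _, h⟩ := hx'
    simp only [Prod.mk.injEq] at h
    exact hab h.2.1.symm

theorem sum_filter_all {M : Type*} [AddCommMonoid M] (p : SpaceCode → Prop) {_ : DecidablePred p}
    (φ : SpaceCode → M) : (((all m).filter fun c => p c).map φ).sum =
      ∑ f ∈ Finset.univ.filter (fun f : PlanarSpace m => p f.code), φ f.code := by
  classical
  rw [← List.sum_toFinset _ (nodup_all.filter _),
    ← Finset.sum_image (f := φ) (code_injective.injOn)]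
  congr 1
  ext c
  simp only [List.mem_toFinset, List.mem_filter, mem_all, decide_eq_true_eq, Finset.mem_image,
    Finset.mem_filter, Finset.mem_univ, true_and]
  constructor
  · rintro ⟨⟨f, rfl⟩, h⟩
    exact ⟨f, h, rfl⟩
  · rintro ⟨f, h, rfl⟩
    exact ⟨⟨f, rfl⟩, h⟩

variable {f g : PlanarSpace m}

/-- Only membership in l matters. Repetitions and disorder must be allowed, as they arise from
adding a point, concatenating and renaming. -/
theorem rank_code {S : Finset (Fin m)} {l : List ℕ} (h : ∀ x, x ∈ l ↔ ∃ i ∈ S, i.val = x) :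
    rank f.code l = f.rank S := by
  have hsub : ∀ 𝓢 : Finset (Finset (Fin m)), (∃ L ∈ familyCode 𝓢, ∀ x ∈ l, x ∈ L) ↔
      ∃ L ∈ 𝓢, S ⊆ L := by
    intro 𝓢
    rw [exists_mem_familyCode]
    refine exists_congr fun L => and_congr_right fun _ => ?_
    simp only [h, forall_exists_index, and_imp, forall_apply_eq_imp_iff₂, val_mem_setCode]
    rfl
  have h0 : l = [] ↔ S = ∅ := by
    rw [List.eq_nil_iff_forall_not_mem, Finset.eq_empty_iff_forall_notMem]
    simp only [h]
    exact ⟨fun H i hi => H _ ⟨i, hi, rfl⟩, fun H x ⟨i, hi, _⟩ => H i hi⟩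
  have h1 : (∀ x ∈ l, ∀ y ∈ l, x = y) ↔ S.card ≤ 1 := by
    rw [Finset.card_le_one]
    simp only [h, forall_exists_index, and_imp, forall_apply_eq_imp_iff₂, Fin.val_inj]
  unfold rank PlanarSpace.rank
  simp only [h0, h1, PlanarSpace.code, hsub]
  by_cases a : S = ∅
  · simp [a]
  · have : 0 < S.card := Finset.card_pos.2 (Finset.nonempty_iff_ne_empty.2 a)
    by_cases b : S.card ≤ 1
    · simp only [a, b, if_true, if_false]; omega
    · simp only [a, b, if_false, PlanarSpace.Collinear, PlanarSpace.Coplanar, false_or]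
      by_cases c : ∃ L ∈ f.lines, S ⊆ L
      · simp [c]
      · simp [c]

theorem rank_setCode {S : Finset (Fin m)} : rank f.code (setCode S) = f.rank S :=
  rank_code fun _ => mem_setCode

theorem rank_cons {S : Finset (Fin m)} {i : Fin m} :
    rank f.code (i.val :: setCode S) = f.rank (insert i S) :=
  rank_code fun x => by simp [mem_setCode, eq_comm]

theorem rank_append {S T : Finset (Fin m)} :
    rank f.code (setCode S ++ setCode T) = f.rank (S ∪ T) :=
  rank_code fun x => by simp [mem_setCode, or_and_right, exists_or]

theorem closureMono_code : ClosureMono f.code ↔ f.ClosureMono := by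
  unfold ClosureMono PlanarSpace.ClosureMono
  change (∀ S ∈ subsets m, ∀ T ∈ subsets m, (∀ x ∈ S, x ∈ T) → ∀ x ∈ List.range m, _) ↔ _
  simp only [forall_mem_subsets, forall_mem_range, forall_mem_setCode, rank_setCode, rank_cons]

theorem spans_code {P : Fin m} {S : Finset (Fin m)} :
    Spans f.code P (setCode S) ↔ f.Spans P S := by
  simp only [Spans, PlanarSpace.Spans, rank_setCode, rank_cons, val_mem_setCode]

theorem located_code {P : Fin m} {d : ℕ} : Located f.code P d ↔ f.Located P d := by
  unfold Located PlanarSpace.Located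
  change ((d = 4 ∧ ∀ S ∈ subsets m, _) ∨ ∃ A ∈ subsets m, ∃ B ∈ subsets m, _ ∧ _ ∧
    (∀ S ∈ subsets m, _) ∧ _) ↔ _
  simp only [forall_mem_subsets, exists_mem_subsets, rank_setCode, rank_append, spans_code]

theorem degenerates_code {P : Fin m} : Degenerates f.code P g.code ↔ f.Degenerates P g := by
  unfold Degenerates PlanarSpace.Degenerates
  change ((∀ S ∈ subsets m, _) ∧ (∀ S ∈ subsets m, _) ∧ ∀ S ∈ subsets m, _) ↔ _
  simp only [forall_mem_subsets, rank_setCode, rank_cons, spans_code, val_mem_setCode]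

theorem coincident_code {P Q : Fin m} : Coincident f.code P Q ↔ f.Coincident P Q := by
  unfold Coincident PlanarSpace.Coincident
  change (_ ∧ ∀ S ∈ subsets m, _) ↔ _
  simp only [forall_mem_subsets, rank_setCode, rank_cons, spans_code, ne_eq, Fin.val_inj]

theorem isDeletion_code {f : PlanarSpace (m + 1)} {P : Fin (m + 1)} :
    IsDeletion f.code P g.code ↔ f.IsDeletion P g := by
  unfold IsDeletion PlanarSpace.IsDeletion
  change (∀ S ∈ subsets m, _) ↔ _
  rw [forall_mem_subsets]
  refine forall_congr' fun S => ?_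
  rw [rank_setCode, rank_code (f := f) (S := S.map P.succAboveEmb)]
  intro x
  -- Deleting P closes the gap in the numbering, so the points from P on are shifted by one.
  have key : ∀ i : Fin m, (P.succAbove i).val = if i.val < P.val then i.val else i.val + 1 := by
    intro i
    by_cases h : i.val < P.val
    · rw [if_pos h, Fin.succAbove_of_castSucc_lt _ _ (by rwa [Fin.lt_def])]; rfl
    · rw [if_neg h, Fin.succAbove_of_le_castSucc _ _ (by rw [Fin.le_def]; exact not_lt.1 h)]; rfl
  simp only [List.mem_map, mem_setCode, Finset.mem_map, Fin.coe_succAboveEmb]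
  constructor
  · rintro ⟨_, ⟨i, hi, rfl⟩, rfl⟩
    exact ⟨_, ⟨i, hi, rfl⟩, key i⟩
  · rintro ⟨_, ⟨i, hi, rfl⟩, rfl⟩
    exact ⟨_, ⟨i, hi, rfl⟩, (key i).symm⟩

theorem mem_tuples {k : ℕ} {l : List ℕ} : l ∈ tuples m k ↔ l.length = k ∧ ∀ x ∈ l, x < m := by
  induction k generalizing l with
  | zero =>
    change l ∈ [[]] ↔ _
    rw [List.mem_singleton, List.length_eq_zero_iff]
    exact ⟨fun h => by simp [h], fun h => h.1⟩
  | succ k ih =>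
    change l ∈ (tuples m k).flatMap (fun l => (List.range m).map fun x => x :: l) ↔ _
    simp only [List.mem_flatMap, List.mem_map, List.mem_range, ih]
    constructor
    · rintro ⟨l, ⟨h1, h2⟩, x, hx, rfl⟩
      exact ⟨by simp [h1], by simpa [hx] using h2⟩
    · rintro ⟨h1, h2⟩
      match l, h1 with
      | x :: l, h1 =>
        simp only [List.length_cons, Nat.add_right_cancel_iff, List.mem_cons, forall_eq_or_imp]
          at h1 h2
        exact ⟨l, ⟨h1, h2.2⟩, x, h2.1, rfl⟩

/-- The tuple need not be a permutation a priori: a repeated entry would send a pair of rank 2 to a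
set of rank 1. A permutation preserving ranks preserves lines and planes by `mem_lines_iff` and
`mem_planes_iff`. -/
theorem isomorphic_code : Isomorphic f.code g.code ↔ f.Isomorphic g := by
  unfold Isomorphic PlanarSpace.Isomorphic
  change (m = m ∧ ∃ π ∈ tuples m m, ∀ S ∈ subsets m, _) ↔ _
  simp only [true_and, forall_mem_subsets, rank_setCode]
  constructor
  · rintro ⟨π, hπ, h⟩
    obtain ⟨hlen, hlt⟩ := mem_tuples.1 hπ
    have hget : ∀ i : Fin m, π.getD i 0 < m := fun i => by
      rw [List.getD_eq_getElem _ _ (by omega)]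
      exact hlt _ (List.getElem_mem _)
    let ρ : Fin m → Fin m := fun i => ⟨π.getD i 0, hget i⟩
    have hρ : ∀ S, g.rank (S.image ρ) = f.rank S := by
      intro S
      rw [← h S]
      refine (rank_code fun x => ?_).symm
      simp only [List.mem_map, mem_setCode, Finset.mem_image]
      constructor
      · rintro ⟨_, ⟨i, hi, rfl⟩, rfl⟩
        exact ⟨_, ⟨i, hi, rfl⟩, rfl⟩
      · rintro ⟨_, ⟨i, hi, rfl⟩, rfl⟩
        exact ⟨_, ⟨i, hi, rfl⟩, rfl⟩
    have hinj : Function.Injective ρ := by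
      intro a b hab
      by_contra hne
      have h1 := hρ {a, b}
      have h2 := PlanarSpace.two_le_rank (f := f) (Finset.card_pair hne).ge
      rw [Finset.image_insert, Finset.image_singleton, hab, Finset.pair_eq_singleton,
        PlanarSpace.rank_of_card_le_one (by simp)] at h1
      rw [← h1] at h2
      simp at h2
    let τ : Equiv.Perm (Fin m) := Equiv.ofBijective ρ (Finite.injective_iff_bijective.1 hinj)
    have hτ : ∀ S, g.rank (S.map τ.toEmbedding) = f.rank S := fun S => by
      rw [← hρ, Finset.map_eq_image]; rfl
    have hins : ∀ x (S : Finset (Fin m)),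
        g.rank (insert (τ x) (S.map τ.toEmbedding)) = f.rank (insert x S) := fun x S => by
      rw [← hτ, Finset.map_insert]; rfl
    have hmem : ∀ x (S : Finset (Fin m)), τ x ∈ S.map τ.toEmbedding ↔ x ∈ S := fun x S =>
      Finset.mem_map' τ.toEmbedding
    refine ⟨τ, fun S => ⟨?_, ?_⟩⟩
    · rw [PlanarSpace.mem_lines_iff, PlanarSpace.mem_lines_iff, ← τ.forall_congr_right]
      simp only [hτ, hins, hmem]
    · rw [PlanarSpace.mem_planes_iff, PlanarSpace.mem_planes_iff, ← τ.forall_congr_right]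
      simp only [hτ, hins, hmem]
  · rintro ⟨ρ, hρ⟩
    have hget : ∀ i : Fin m, (List.ofFn fun i => (ρ i).val).getD i 0 = ρ i := fun i => by
      rw [List.getD_eq_getElem _ _ (by simp)]
      simp
    refine ⟨List.ofFn fun i => (ρ i).val, mem_tuples.2 ⟨by simp, by simp [List.mem_ofFn]⟩,
      fun S => ?_⟩
    rw [rank_code (f := g) (S := S.map ρ.toEmbedding)]
    · unfold PlanarSpace.rank
      rw [Finset.card_map, PlanarSpace.Isomorphic.collinear (fun T => (hρ T).1),
        PlanarSpace.Isomorphic.coplanar hρ]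
    · intro x
      simp only [List.mem_map, mem_setCode, Finset.mem_map, Equiv.coe_toEmbedding]
      constructor
      · rintro ⟨_, ⟨i, hi, rfl⟩, rfl⟩
        exact ⟨_, ⟨i, hi, rfl⟩, (hget i).symm⟩
      · rintro ⟨_, ⟨i, hi, rfl⟩, rfl⟩
        exact ⟨_, ⟨i, hi, rfl⟩, hget i⟩

end SpaceCode

/-! ### Values of terms, and termination of the reduction. -/

theorem List.sum_map_flatMap {α β M : Type*} [AddMonoid M] (l : List α) (g : α → List β)
    (φ : β → M) : ((l.flatMap g).map φ).sum = (l.map fun x => ((g x).map φ).sum).sum := by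
  induction l with
  | nil => rfl
  | cons x l ih => rw [List.flatMap_cons, List.map_append, List.sum_append, ih]; rfl

theorem List.sum_map_range {M : Type*} [AddCommMonoid M] (n : ℕ) (φ : ℕ → M) :
    ((List.range n).map φ).sum = ∑ i ∈ Finset.range n, φ i := by
  rw [← List.sum_toFinset _ List.nodup_range, List.toFinset_range]

namespace SpaceCode

variable {m : ℕ}

section Value

variable (F : Type u) [Field F]

/-- The number of strong realizations of the planar space with code `c`. -/
noncomputable def count (c : SpaceCode) : ℕ :=
  Nat.card {σ : Fin c.1 → P3 F // ∀ S, pointRank σ S = rank c (setCode S)}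

theorem count_code (f : PlanarSpace m) : count F f.code = f.realizationCount F := by
  have h : ∀ σ : Fin m → P3 F, (∀ S, pointRank σ S = rank f.code (setCode S)) ↔
      f.IsStrongRealization σ := fun σ => by
    simp only [PlanarSpace.isStrongRealization_iff, rank_setCode]
  exact Nat.card_congr (Equiv.subtypeEquivRight h)

/-- The value of a term. -/
noncomputable def value [Fintype F] (t : CodeTerm) : ℤ :=
  (-1) ^ t.1 * (Fintype.card F : ℤ) ^ t.2.1 * count F t.2.2

end Value

open Classical in
theorem length_coincident {f : PlanarSpace m} {P : Fin m} :
    ((List.range m).filter fun Q => Coincident f.code P Q).length =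
      (Finset.univ.filter (f.Coincident P)).card := by
  rw [← List.toFinset_card_of_nodup (List.nodup_range.filter _),
    ← Finset.card_map Fin.valEmbedding]
  congr 1
  ext x
  simp only [List.mem_toFinset, List.mem_filter, List.mem_range, decide_eq_true_eq,
    Finset.mem_map, Finset.mem_filter, Finset.mem_univ, true_and, Fin.valEmbedding_apply]
  constructor
  · rintro ⟨hx, h⟩
    exact ⟨⟨x, hx⟩, coincident_code.1 h, rfl⟩
  · rintro ⟨i, hi, rfl⟩
    exact ⟨i.2, coincident_code.2 hi⟩

/-- This is `Located.count` solved for the count of f and multiplied by the signed power of q. As f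
is among its own degenerations, it is left out of the subtracted terms. -/
theorem sum_value_reduce (F : Type u) [Field F] [Fintype F] {f : PlanarSpace (m + 1)}
    {P : Fin (m + 1)} {d : ℕ} (h : f.Located P d) (s e : ℕ) :
    ((reduce (s, e, f.code) (P.val, d)).map (value F)).sum = value F (s, e, f.code) := by
  classical
  have hcount := h.count (F := F)
  have h1 : ((((all (m + 1)).filter fun g => Degenerates f.code P g ∧ g ≠ f.code).map
      (fun g => (s + 1, e, g))).map (value F)).sum =
      - ((-1) ^ s * (Fintype.card F : ℤ) ^ e) *
        ((∑ g ∈ Finset.univ.filter (f.Degenerates P), (g.realizationCount F : ℤ)) -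
          f.realizationCount F) := by
    rw [List.map_map, sum_filter_all,
      ← Finset.sum_erase_eq_sub (by simpa using f.degenerates_self P), Finset.mul_sum]
    refine Finset.sum_congr ?_ fun g _ => ?_
    · ext g
      simp only [Finset.mem_filter, Finset.mem_univ, true_and, Finset.mem_erase,
        degenerates_code, code_injective.ne_iff]
      exact and_comm
    · simp only [Function.comp_apply, value, count_code, pow_succ]
      ring
  have h2 : ((((all m).filter fun g => IsDeletion f.code P g).flatMap fun g =>
      (List.range d).map (fun i => (s, e + i, g)) ++
        ((List.range (m + 1)).filter fun Q => Coincident f.code P Q).map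
          fun _ => (s + 1, e, g)).map (value F)).sum =
      ((-1) ^ s * (Fintype.card F : ℤ) ^ e) *
        ((∑ i ∈ Finset.range d, (Fintype.card F : ℤ) ^ i) -
          (Finset.univ.filter (f.Coincident P)).card) *
        ∑ g ∈ Finset.univ.filter (f.IsDeletion P), (g.realizationCount F : ℤ) := by
    rw [List.sum_map_flatMap, sum_filter_all, Finset.mul_sum]
    refine Finset.sum_congr ?_ fun g _ => ?_
    · ext g
      simp only [Finset.mem_filter, Finset.mem_univ, true_and, isDeletion_code]
    · rw [List.map_append, List.sum_append, List.map_map, List.map_map, List.sum_map_range]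
      have hconst : (value F ∘ fun _ : ℕ => (s + 1, e, g.code)) =
          fun _ => value F (s + 1, e, g.code) := rfl
      rw [hconst, List.map_const', List.sum_replicate, length_coincident]
      simp only [Function.comp_apply, value, count_code, pow_add, ← Finset.mul_sum,
        ← Finset.sum_mul, nsmul_eq_mul]
      ring
  have h3 : reduce (s, e, f.code) (P.val, d) =
      ((all (m + 1)).filter fun g => Degenerates f.code P g ∧ g ≠ f.code).map
        (fun g => (s + 1, e, g)) ++
      ((all m).filter fun g => IsDeletion f.code P g).flatMap fun g =>
        (List.range d).map (fun i => (s, e + i, g)) ++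
          ((List.range (m + 1)).filter fun Q => Coincident f.code P Q).map
            fun _ => (s + 1, e, g) := by
    unfold reduce
    congr!
  rw [h3, List.map_append, List.sum_append, h1, h2]
  have hcount' := congrArg (Nat.cast : ℕ → ℤ) hcount
  push_cast at hcount'
  simp only [value, count_code]
  linear_combination -(((-1) ^ s * (Fintype.card F : ℤ) ^ e)) * hcount'

theorem exists_located_of_candidates {f : PlanarSpace m} (h : candidates f.code ≠ []) :
    ∃ (P : Fin m) (d : ℕ), (candidates f.code).headI = (P.val, d) ∧ f.Located P d := by
  classical
  have hmem : (candidates f.code).headI ∈ candidates f.code := by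
    cases hc : candidates f.code with
    | nil => exact absurd hc h
    | cons a l => simp
  generalize (candidates f.code).headI = y at hmem ⊢
  simp only [candidates, List.mem_filter, List.mem_flatMap, List.mem_map, List.mem_range,
    decide_eq_true_eq] at hmem
  obtain ⟨⟨P, hP, d, -, rfl⟩, h⟩ := hmem
  exact ⟨⟨P, hP⟩, d, rfl, located_code.1 h⟩

theorem sum_value_step (F : Type u) [Field F] [Fintype F] (f : PlanarSpace m) (s e : ℕ) :
    ((step (s, e, f.code)).map (value F)).sum = value F (s, e, f.code) := by
  unfold step
  split_ifs with h1 h2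
  · simp
  · obtain ⟨P, d, h, hd⟩ := exists_located_of_candidates h2
    rw [h]
    cases m with
    | zero => exact P.elim0
    | succ m => exact sum_value_reduce F hd s e
  · have : f.realizationCount F = 0 := by
      have : IsEmpty {σ : Fin m → P3 F // f.IsStrongRealization σ} :=
        ⟨fun σ => h1 (closureMono_code.2 σ.2.closureMono)⟩
      exact Nat.card_of_isEmpty
    simp [value, count_code, this]

/-- The measure that decreases in each step. -/
noncomputable def weight (f : PlanarSpace m) : ℕ := m + ∑ S, f.rank S

theorem weight_le (f : PlanarSpace m) : weight f ≤ stepBound m := by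
  have : ∑ S, f.rank S ≤ _ := Finset.sum_le_card_nsmul Finset.univ f.rank 4
    fun S _ => PlanarSpace.rank_le_four
  rw [Finset.card_univ, Fintype.card_finset, Fintype.card_fin, smul_eq_mul] at this
  rw [weight, stepBound, length_subsets]
  omega

theorem weight_lt_of_degenerates {f g : PlanarSpace m} {P : Fin m} (h : f.Degenerates P g)
    (hne : g ≠ f) : weight g < weight f := by
  refine Nat.add_lt_add_left (Finset.sum_lt_sum (fun S _ => h.2.2 S) ?_) _
  by_contra! hle
  exact hne (PlanarSpace.rank_injective (funext fun S =>
    (h.2.2 S).antisymm (hle S (Finset.mem_univ _))))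

/-- The subsets avoiding P account for part of the sum of the ranks of f, and the summand m + 1
makes the drop strict. -/
theorem weight_lt_of_isDeletion {f : PlanarSpace (m + 1)} {g : PlanarSpace m} {P : Fin (m + 1)}
    (h : f.IsDeletion P g) : weight g < weight f := by
  have h1 : ∑ S, g.rank S ≤ ∑ S, f.rank S := by
    rw [Finset.sum_congr rfl fun S _ => h S]
    exact (Finset.sum_map Finset.univ (Finset.mapEmbedding P.succAboveEmb).toEmbedding
      f.rank).ge.trans (Finset.sum_le_sum_of_subset (Finset.subset_univ _))
  unfold weight
  omega

/-- A term for a planar space on at most `n` points that is completely reduced after `k` steps. -/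
def Bounded (n k : ℕ) (t : CodeTerm) : Prop :=
  ∃ m ≤ n, ∃ f : PlanarSpace m, t.2.2 = f.code ∧
    ((f.ClosureMono ∧ candidates f.code = []) ∨ weight f ≤ k)

theorem bounded_stepBound (f : PlanarSpace m) (s e : ℕ) :
    Bounded m (stepBound m) (s, e, f.code) := ⟨m, le_rfl, f, rfl, .inr (weight_le f)⟩

/-- A finished term is returned unchanged, a term violating `ClosureMono` disappears, and any other
term is replaced by terms of smaller weight. -/
theorem Bounded.step {n k : ℕ} {t : CodeTerm} (h : Bounded n (k + 1) t) :
    ∀ t' ∈ step t, Bounded n k t' := by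
  classical
  obtain ⟨s, e, c⟩ := t
  obtain ⟨m, hm, f, rfl, h⟩ := h
  intro t' ht'
  unfold SpaceCode.step at ht'
  split_ifs at ht' with h1 h2
  · rw [List.mem_singleton] at ht'
    exact ⟨m, hm, f, by rw [ht'], .inl ⟨closureMono_code.1 h1, h2⟩⟩
  · have hw : weight f ≤ k + 1 := h.resolve_left fun h => h2 h.2
    obtain ⟨P, d, hy, hd⟩ := exists_located_of_candidates h2
    rw [hy] at ht'
    cases m with
    | zero => exact P.elim0
    | succ m =>
      rw [reduce, List.mem_append] at ht'
      rcases ht' with ht' | ht'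
      · simp only [List.mem_map, List.mem_filter, decide_eq_true_eq] at ht'
        obtain ⟨c, ⟨hc, hdeg, hne⟩, rfl⟩ := ht'
        obtain ⟨g, rfl⟩ := mem_all.1 hc
        have := weight_lt_of_degenerates (degenerates_code.1 hdeg) (code_injective.ne_iff.1 hne)
        exact ⟨m + 1, hm, g, rfl, .inr (by omega)⟩
      · simp only [List.mem_flatMap, List.mem_filter, decide_eq_true_eq] at ht'
        obtain ⟨c, ⟨hc, hdel⟩, ht'⟩ := ht'
        obtain ⟨g, rfl⟩ := mem_all.1 hc
        have hc' : t'.2.2 = PlanarSpace.code g := by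
          rw [List.mem_append, List.mem_map, List.mem_map] at ht'
          rcases ht' with ⟨i, -, rfl⟩ | ⟨i, -, rfl⟩ <;> rfl
        have h3 := weight_lt_of_isDeletion (isDeletion_code.1 hdel)
        exact ⟨m, by omega, g, hc', .inr (by omega)⟩
  · simp at ht'

theorem Bounded.isHyperfiguration {n : ℕ} {t : CodeTerm} (h : Bounded n 0 t) :
    ∃ m ≤ n, ∃ f : PlanarSpace m, t.2.2 = f.code ∧ f.IsHyperfiguration := by
  classical
  obtain ⟨m, hm, f, hc, h⟩ := h
  refine ⟨m, hm, f, hc, fun P => ?_⟩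
  rcases h with ⟨h1, h2⟩ | h
  · by_contra hP
    obtain ⟨d, hd⟩ := h1.exists_located hP
    -- The candidate list tries all d below 9, which suffices because d is at most the sum of two
    -- ranks.
    have hlt : d < 9 := by
      have h4 : ∀ S, f.rank S ≤ 4 := fun S => PlanarSpace.rank_le_four
      rcases hd with ⟨rfl, -⟩ | ⟨A, B, -, -, -, rfl⟩
      · norm_num
      · have := h4 A
        have := h4 B
        omega
    have : (P.val, d) ∈ candidates f.code := by
      simp only [candidates, List.mem_filter, List.mem_flatMap, List.mem_map, List.mem_range,
        decide_eq_true_eq]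
      exact ⟨⟨P, P.2, d, hlt, rfl⟩, located_code.2 hd⟩
    rw [h2] at this
    simp at this
  -- Weight 0 leaves no points, so the index condition is vacuous.
  · have := P.2
    unfold weight at h
    omega

theorem bounded_iterate {n : ℕ} (k : ℕ) (ts : List CodeTerm) (h : ∀ t ∈ ts, Bounded n k t) :
    ∀ t ∈ (fun ts => ts.flatMap step)^[k] ts, Bounded n 0 t := by
  induction k generalizing ts with
  | zero => exact h
  | succ k ih =>
    rw [Function.iterate_succ_apply]
    refine ih _ fun t' ht' => ?_
    obtain ⟨t, ht, ht'⟩ := List.mem_flatMap.1 ht'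
    exact (h t ht).step t' ht'

theorem sum_value_iterate (F : Type u) [Field F] [Fintype F] {n : ℕ} (k : ℕ) (ts : List CodeTerm)
    (h : ∀ t ∈ ts, Bounded n k t) :
    (((fun ts => ts.flatMap step)^[k] ts).map (value F)).sum = (ts.map (value F)).sum := by
  induction k generalizing ts with
  | zero => rfl
  | succ k ih =>
    rw [Function.iterate_succ_apply, ih, List.sum_map_flatMap]
    · refine congrArg List.sum (List.map_congr_left fun t ht => ?_)
      obtain ⟨m, -, f, hf, -⟩ := h t ht
      obtain ⟨s, e, c⟩ := t
      obtain rfl : c = f.code := hf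
      exact sum_value_step F f s e
    · intro t' ht'
      obtain ⟨t, ht, ht'⟩ := List.mem_flatMap.1 ht'
      exact (h t ht).step t' ht'

/-- Steps act on each term separately. This makes the output for caps the sum of the outputs for
single planar spaces. -/
theorem run_append (n : ℕ) (ts ts' : List CodeTerm) :
    run n (ts ++ ts') = run n ts ++ run n ts' := by
  unfold run
  generalize stepBound n = k
  induction k generalizing ts ts' with
  | zero => rfl
  | succ k ih => simp only [Function.iterate_succ_apply, List.flatMap_append, ih]

theorem run_nil (n : ℕ) : run n [] = [] := by
  have h := congrArg List.length (run_append n [] [])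
  rw [List.append_nil, List.length_append] at h
  exact List.length_eq_zero_iff.1 (by omega)

theorem sum_map_run {M : Type*} [AddMonoid M] (n : ℕ) (ts : List CodeTerm) (φ : CodeTerm → M) :
    ((run n ts).map φ).sum = (ts.map fun t => ((run n [t]).map φ).sum).sum := by
  induction ts with
  | nil => rw [run_nil]; rfl
  | cons t ts ih =>
    rw [← List.singleton_append, run_append, List.map_append, List.sum_append, ih]
    rfl

end SpaceCode

/-! ### Collecting terms into polynomials. -/

theorem List.sum_map_filter_eq_sum_ite {α M : Type*} [AddMonoid M] (l : List α) (p : α → Prop)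
    {_ : DecidablePred p} (φ : α → M) :
    ((l.filter fun x => p x).map φ).sum = (l.map fun x => if p x then φ x else 0).sum := by
  induction l with
  | nil => rfl
  | cons x l ih =>
    rw [List.filter_cons, List.map_cons, List.sum_cons, ← ih]
    by_cases h : p x <;> simp [h]

theorem polyOfCoeffs_map_range (n : ℕ) (g : ℕ → ℤ) :
    polyOfCoeffs ((List.range n).map g) = ∑ j ∈ Finset.range n, C (g j) * X ^ j := by
  induction n generalizing g with
  | zero => rfl
  | succ n ih =>
    rw [List.range_succ_eq_map, List.map_cons, List.map_map, Finset.sum_range_succ']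
    change C (g 0) + X * polyOfCoeffs _ = _
    rw [ih, Finset.mul_sum, pow_zero, mul_one, add_comm]
    congr 1
    refine Finset.sum_congr rfl fun j _ => ?_
    rw [Function.comp_apply, pow_succ]
    ring

namespace SpaceCode

/-- The monomial of a term. -/
noncomputable def monomial (t : CodeTerm) : ℤ[X] := (-1) ^ t.1 * X ^ t.2.1

theorem sum_coeffs_eq (n : ℕ) (ts : List CodeTerm) (h : ∀ t ∈ ts, t.2.1 < n) :
    ∑ j ∈ Finset.range n,
      C ((((ts.filter fun t => t.2.1 = j ∧ t.1 % 2 = 0).length : ℕ) : ℤ) -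
        ((ts.filter fun t => t.2.1 = j ∧ t.1 % 2 ≠ 0).length : ℕ)) * X ^ j =
      (ts.map monomial).sum := by
  induction ts with
  | nil => simp
  | cons t ts ih =>
    rw [List.map_cons, List.sum_cons, ← ih fun t ht => h t (List.mem_cons_of_mem _ ht)]
    have ht : monomial t = ∑ j ∈ Finset.range n,
        if t.2.1 = j then (-1) ^ t.1 * X ^ j else 0 := by
      rw [Finset.sum_ite_eq, if_pos (Finset.mem_range.2 (h t List.mem_cons_self))]
      rfl
    rw [ht, ← Finset.sum_add_distrib]
    refine Finset.sum_congr rfl fun j _ => ?_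
    by_cases hj : t.2.1 = j
    · by_cases hs : t.1 % 2 = 0
      · rw [List.filter_cons_of_pos (by simp [hj, hs]), List.filter_cons_of_neg (by simp [hs]),
          if_pos hj, (Nat.even_iff.2 hs).neg_one_pow, List.length_cons]
        push_cast
        simp only [map_sub, map_add, map_one]
        ring
      · have hs' : Odd t.1 := Nat.odd_iff.2 (by omega)
        rw [List.filter_cons_of_neg (by simp [hs]), List.filter_cons_of_pos (by simp [hj, hs]),
          if_pos hj, hs'.neg_one_pow, List.length_cons]
        push_cast
        simp only [map_sub, map_add, map_one]
        ring
    · rw [List.filter_cons_of_neg (by simp [hj]), List.filter_cons_of_neg (by simp [hj]),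
        if_neg hj, zero_add]

theorem polyOfCoeffs_coeffs (ts : List CodeTerm) :
    polyOfCoeffs (coeffs ts) = (ts.map monomial).sum := by
  rw [coeffs, polyOfCoeffs_map_range]
  -- The coefficient list is long enough: its length is one more than the sum of all exponents,
  -- which bounds each of them.
  refine sum_coeffs_eq _ _ fun t ht => Nat.lt_succ_of_le ?_
  induction ts with
  | nil => simp at ht
  | cons a ts ih =>
    rw [List.foldr_cons]
    rcases List.mem_cons.1 ht with rfl | ht
    · exact Nat.le_add_right _ _
    · exact (ih ht).trans (Nat.le_add_left _ _)

theorem polyOfCoeffs_constCoeffs (ts : List CodeTerm) :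
    polyOfCoeffs (constCoeffs ts) =
      (ts.map fun t => if t.2.2.1 = 0 then monomial t else 0).sum := by
  rw [constCoeffs, polyOfCoeffs_coeffs, List.sum_map_filter_eq_sum_ite]

open Classical in
theorem polyOfCoeffs_isoCoeffs (ts : List CodeTerm) (h : SpaceCode) :
    polyOfCoeffs (isoCoeffs ts h) =
      (ts.map fun t => if Isomorphic t.2.2 h then monomial t else 0).sum := by
  rw [isoCoeffs, polyOfCoeffs_coeffs, List.sum_map_filter_eq_sum_ite]

end SpaceCode

/-! ### Isomorphism classes and the resulting formulas. -/

namespace HyperfigurationClass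

variable {k : ℕ}

/-- A representative of an isomorphism class. -/
noncomputable def rep (h : HyperfigurationClass k) : Hyperfiguration k :=
  Quotient.out (s := hyperfigurationSetoid k) h

theorem mk_rep (h : HyperfigurationClass k) : mk h.rep = h :=
  Quotient.out_eq (s := hyperfigurationSetoid k) h

theorem mk_eq_mk_iff {f g : Hyperfiguration k} : mk f = mk g ↔ f.1.Isomorphic g.1 :=
  Quotient.eq (r := hyperfigurationSetoid k)

theorem realizationCount_mk (f : Hyperfiguration k) (F : Type u) [Field F] :
    (mk f).realizationCount F = f.1.realizationCount F := rfl

theorem isomorphic_rep_iff {f : Hyperfiguration k} {h : HyperfigurationClass k} :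
    f.1.Isomorphic h.rep.1 ↔ h = mk f := by
  rw [← mk_eq_mk_iff, mk_rep, eq_comm]

end HyperfigurationClass

namespace SpaceCode

open HyperfigurationClass

/-- The polynomial of the terms without points. -/
noncomputable def constPoly (ts : List CodeTerm) : ℤ[X] := polyOfCoeffs (constCoeffs ts)

/-- The polynomial of the terms in an isomorphism class of hyperfigurations. -/
noncomputable def classPoly (ts : List CodeTerm) (k : ℕ) (h : HyperfigurationClass k) : ℤ[X] :=
  polyOfCoeffs (isoCoeffs ts h.rep.1.code)

/-- The polynomial of a class is defined by a chosen representative, but the algorithm receives an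
arbitrary one. Both select the same terms, as isomorphism is transitive. -/
theorem isoCoeffs_rep (n : ℕ) (ts : List CodeTerm) {k : ℕ} (f : Hyperfiguration k)
    (hts : ∀ t ∈ ts, Bounded n 0 t) :
    isoCoeffs ts (mk f).rep.1.code = isoCoeffs ts f.1.code := by
  unfold isoCoeffs
  congr 1
  refine List.filter_congr fun t ht => ?_
  obtain ⟨m, -, g, hg, -⟩ := hts t ht
  rw [decide_eq_decide, hg]
  by_cases hmk : m = k
  · subst hmk
    have h1 : (mk f).rep.1.Isomorphic f.1 := mk_eq_mk_iff.1 (mk_rep _)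
    rw [isomorphic_code, isomorphic_code]
    exact ⟨fun h => h.trans h1, fun h => h.trans h1.symm⟩
  · exact ⟨fun h => absurd h.1 hmk, fun h => absurd h.1 hmk⟩

theorem count_zero (F : Type u) [Field F] (f : PlanarSpace 0) : f.realizationCount F = 1 := by
  rw [← count_code, count, Nat.card_eq_one_iff_unique]
  have hS : ∀ σ : Fin 0 → P3 F, ∀ S, pointRank σ S = rank f.code (setCode S) := fun σ S => by
    rw [rank_setCode, Finset.eq_empty_of_isEmpty S, pointRank_empty,
      PlanarSpace.rank_of_card_le_one (by simp)]
    rfl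
  exact ⟨⟨fun a b => Subtype.ext (Subsingleton.elim (α := Fin 0 → P3 F) _ _)⟩,
    ⟨⟨Fin.elim0, hS _⟩⟩⟩

theorem eval_monomial (F : Type u) [Field F] [Fintype F] (t : CodeTerm) :
    value F t = (monomial t).eval (Fintype.card F : ℤ) * count F t.2.2 := by
  simp [value, monomial]

-- A finished term has no points, and then its count is 1, or it lies in exactly one of the
-- isomorphism classes over which the sum runs.
open Classical in
theorem value_eq (F : Type u) [Field F] [Fintype F] {n : ℕ} {t : CodeTerm} (h : Bounded n 0 t) :
    value F t =
      (if t.2.2.1 = 0 then (monomial t).eval (Fintype.card F : ℤ) else 0) +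
      ∑ k ∈ Finset.Icc 1 n, ∑ h : HyperfigurationClass k,
        (if Isomorphic t.2.2 h.rep.1.code then (monomial t).eval (Fintype.card F : ℤ) else 0) *
          (h.realizationCount F : ℤ) := by
  obtain ⟨m, hm, f, hf, hyp⟩ := h.isHyperfiguration
  rw [eval_monomial, hf, count_code]
  have hne : ∀ k ≠ m, ∀ h : HyperfigurationClass k, ¬ Isomorphic f.code h.rep.1.code :=
    fun k hk h h' => hk h'.1.symm
  by_cases h0 : m = 0
  · subst h0
    rw [Finset.sum_eq_zero, if_pos (show f.code.1 = 0 from rfl),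
      count_zero]
    · simp
    · intro k hk
      refine Finset.sum_eq_zero fun h _ => ?_
      rw [if_neg (hne k (by have := Finset.mem_Icc.1 hk; omega) h), zero_mul]
  · rw [if_neg (show ¬ f.code.1 = 0 from h0), zero_add,
      Finset.sum_eq_single_of_mem m (Finset.mem_Icc.2 ⟨by omega, hm⟩)]
    · rw [Finset.sum_eq_single_of_mem (mk ⟨f, hyp⟩) (Finset.mem_univ _)]
      · rw [if_pos (isomorphic_code.2 ((isomorphic_rep_iff (f := ⟨f, hyp⟩)).2 rfl)),
          realizationCount_mk]
      · intro h _ hh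
        rw [if_neg, zero_mul]
        intro h'
        exact hh ((isomorphic_rep_iff (f := ⟨f, hyp⟩)).1 (isomorphic_code.1 h'))
    · intro k _ hk
      refine Finset.sum_eq_zero fun h _ => ?_
      rw [if_neg (hne k hk h), zero_mul]

theorem sum_value_eq_hyperfigurationSum (F : Type u) [Field F] [Fintype F] (n : ℕ)
    (ts : List CodeTerm) (hts : ∀ t ∈ ts, Bounded n 0 t) :
    (ts.map (value F)).sum = hyperfigurationSum n (constPoly ts) (classPoly ts) F := by
  classical
  simp only [hyperfigurationSum, constPoly, classPoly, polyOfCoeffs_constCoeffs,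
    polyOfCoeffs_isoCoeffs]
  induction ts with
  | nil => simp
  | cons t ts ih =>
    rw [List.map_cons, List.sum_cons, ih fun t ht => hts t (List.mem_cons_of_mem _ ht),
      value_eq F (hts t List.mem_cons_self)]
    simp only [List.map_cons, List.sum_cons, eval_add, add_mul, Finset.sum_add_distrib,
      apply_ite (eval (Fintype.card F : ℤ)), eval_zero]
    ring

/-- The terms into which the planar space `f` is reduced. -/
noncomputable def spaceTerms {m : ℕ} (f : PlanarSpace m) : List CodeTerm :=
  run m [(0, 0, f.code)]

theorem bounded_spaceTerms {m : ℕ} (f : PlanarSpace m) : ∀ t ∈ spaceTerms f, Bounded m 0 t :=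
  bounded_iterate _ _ (by simpa using bounded_stepBound f 0 0)

theorem realizationCount_eq {m : ℕ} (f : PlanarSpace m) (F : Type u) [Field F] [Fintype F] :
    (f.realizationCount F : ℤ) =
      hyperfigurationSum m (constPoly (spaceTerms f)) (classPoly (spaceTerms f)) F := by
  rw [← sum_value_eq_hyperfigurationSum F m _ (bounded_spaceTerms f), spaceTerms, run,
    sum_value_iterate F (n := m) _ _ (by simpa using bounded_stepBound f 0 0)]
  simp [value, count_code]

/-- All these spaces have n points, so the joint run and the separate runs take the same number of
steps. -/
theorem sum_run_capTerms {M : Type*} [AddCommMonoid M] (n : ℕ) (φ : CodeTerm → M) :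
    ((run n (capTerms n)).map φ).sum =
      ∑ f ∈ PlanarSpace.withoutFullLines n, ((spaceTerms f).map φ).sum := by
  rw [sum_map_run, capTerms, List.map_map, sum_filter_all]
  refine Finset.sum_congr ?_ fun f _ => rfl
  ext f
  simp only [PlanarSpace.withoutFullLines, Finset.mem_filter, Finset.mem_univ, true_and,
    PlanarSpace.code, forall_mem_familyCode, length_setCode]

theorem bounded_run_capTerms (n : ℕ) : ∀ t ∈ run n (capTerms n), Bounded n 0 t := by
  refine bounded_iterate _ _ fun t ht => ?_
  simp only [capTerms, List.mem_map, List.mem_filter] at ht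
  obtain ⟨c, ⟨hc, -⟩, rfl⟩ := ht
  obtain ⟨f, rfl⟩ := mem_all.1 hc
  exact bounded_stepBound f 0 0

theorem constPoly_run_capTerms (n : ℕ) : constPoly (run n (capTerms n)) =
    ∑ f ∈ PlanarSpace.withoutFullLines n, constPoly (spaceTerms f) := by
  simp only [constPoly, polyOfCoeffs_constCoeffs]
  exact sum_run_capTerms n _

theorem classPoly_run_capTerms (n k : ℕ) (h : HyperfigurationClass k) :
    classPoly (run n (capTerms n)) k h =
      ∑ f ∈ PlanarSpace.withoutFullLines n, classPoly (spaceTerms f) k h := by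
  simp only [classPoly, polyOfCoeffs_isoCoeffs]
  exact sum_run_capTerms n _

theorem hyperfigurationSum_sum {ι : Type*} (F : Type u) [Field F] [Fintype F] (n : ℕ)
    (s : Finset ι) (p : ι → ℤ[X]) (ph : ι → ∀ k : ℕ, HyperfigurationClass k → ℤ[X]) :
    hyperfigurationSum n (∑ i ∈ s, p i) (fun k h => ∑ i ∈ s, ph i k h) F =
      ∑ i ∈ s, hyperfigurationSum n (p i) (ph i) F := by
  simp only [hyperfigurationSum, eval_finsetSum, Finset.sum_add_distrib, Finset.sum_mul]
  congr 1
  rw [Finset.sum_comm]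
  exact Finset.sum_congr rfl fun k _ => Finset.sum_comm

theorem capCount_eq (n : ℕ) (F : Type u) [Field F] [Fintype F] :
    (capCount n F : ℤ) = hyperfigurationSum n (constPoly (run n (capTerms n)))
      (classPoly (run n (capTerms n))) F := by
  have h : classPoly (run n (capTerms n)) =
      fun k h => ∑ f ∈ PlanarSpace.withoutFullLines n, classPoly (spaceTerms f) k h := by
    funext k h
    exact classPoly_run_capTerms n k h
  rw [h, constPoly_run_capTerms, hyperfigurationSum_sum, PlanarSpace.capCount_eq_sum,
    Nat.cast_sum]
  exact Finset.sum_congr rfl fun f _ => realizationCount_eq f F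

end SpaceCode

/-! ### The main theorem. -/

theorem mainTheorem2 :
    ∃ (s : ℕ → ℤ[X]) (sh : ∀ n k : ℕ, HyperfigurationClass k → ℤ[X]),
      -- the formula for the number of caps
      (∀ (n : ℕ) (F : Type u) [Field F] [Fintype F],
        (capCount n F : ℤ) = hyperfigurationSum n (s n) (sh n) F) ∧
      -- the polynomials are produced by an algorithm
      AlgorithmicallyComputable (fun n : ℕ => n) s ∧
      AlgorithmicallyComputable
        (fun b : ℕ × (Σ k, Hyperfiguration k) => (b.1, b.2.2.1.code))
        (fun b => sh b.1 b.2.1 (HyperfigurationClass.mk b.2.2)) ∧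
      -- namely the following one: step 1 finds such an expression for `A_f(4, q)`, for each `f`
      ∃ (r : ∀ m : ℕ, PlanarSpace m → ℤ[X])
        (rh : ∀ m : ℕ, PlanarSpace m → ∀ k : ℕ, HyperfigurationClass k → ℤ[X]),
        (∀ (m : ℕ) (f : PlanarSpace m) (F : Type u) [Field F] [Fintype F],
          (f.realizationCount F : ℤ) = hyperfigurationSum m (r m f) (rh m f) F) ∧
        AlgorithmicallyComputable
          (fun b : (Σ m, PlanarSpace m) => b.2.code) (fun b => r b.1 b.2) ∧
        AlgorithmicallyComputable
          (fun b : (Σ m, PlanarSpace m) × (Σ k, Hyperfiguration k) =>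
            (b.1.2.code, b.2.2.1.code))
          (fun b => rh b.1.1 b.1.2 b.2.1 (HyperfigurationClass.mk b.2.2)) ∧
        -- step 2 adds the expressions for the `f` on `n` points without full lines
        (∀ (n : ℕ) (F : Type u) [Field F] [Fintype F],
          capCount n F = ∑ f ∈ PlanarSpace.withoutFullLines n, f.realizationCount F) ∧
        (∀ n : ℕ, s n = ∑ f ∈ PlanarSpace.withoutFullLines n, r n f) ∧
        (∀ (n k : ℕ) (h : HyperfigurationClass k),
          sh n k h = ∑ f ∈ PlanarSpace.withoutFullLines n, rh n f k h) := by
  refine ⟨fun n => SpaceCode.constPoly (SpaceCode.run n (SpaceCode.capTerms n)),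
    fun n => SpaceCode.classPoly (SpaceCode.run n (SpaceCode.capTerms n)),
    fun n F _ _ => SpaceCode.capCount_eq n F,
    ⟨fun n => SpaceCode.constCoeffs (SpaceCode.run n (SpaceCode.capTerms n)), ?_, fun _ => rfl⟩,
    ⟨fun x => SpaceCode.isoCoeffs (SpaceCode.run x.1 (SpaceCode.capTerms x.1)) x.2, ?_,
      fun b => ?_⟩,
    fun m f => SpaceCode.constPoly (SpaceCode.spaceTerms f),
    fun m f => SpaceCode.classPoly (SpaceCode.spaceTerms f),
    fun m f F _ _ => SpaceCode.realizationCount_eq f F,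
    ⟨fun c : SpaceCode => SpaceCode.constCoeffs (SpaceCode.run c.1 [(0, 0, c)]), ?_,
      fun _ => rfl⟩,
    ⟨fun x : SpaceCode × SpaceCode =>
      SpaceCode.isoCoeffs (SpaceCode.run x.1.1 [(0, 0, x.1)]) x.2, ?_, fun b => ?_⟩,
    fun n _ _ _ => PlanarSpace.capCount_eq_sum n,
    SpaceCode.constPoly_run_capTerms,
    SpaceCode.classPoly_run_capTerms⟩
  · exact (SpaceCode.primrec_constCoeffs.comp (by fun_prop)).to_comp
  · exact (SpaceCode.primrec_isoCoeffs.comp (by fun_prop) (by fun_prop)).to_comp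
  · exact (congrArg polyOfCoeffs
      (SpaceCode.isoCoeffs_rep b.1 _ b.2.2 (SpaceCode.bounded_run_capTerms b.1))).symm
  · exact (SpaceCode.primrec_constCoeffs.comp (by fun_prop)).to_comp
  · exact (SpaceCode.primrec_isoCoeffs.comp (by fun_prop) (by fun_prop)).to_comp
  · exact (congrArg polyOfCoeffs
      (SpaceCode.isoCoeffs_rep b.1.1 _ b.2.2 (SpaceCode.bounded_spaceTerms b.1.2))).symm
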